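/- Let $(M,g_0)$ be a smooth closed (compact, without boundary) Riemannian manifold of dimension $n\ge 3$, and let $3\le k\le n$. For $\tau\in\mathbb R$ let $$A^{\tau}_{g_0}=\frac1{n-2}\Big(\mathrm{Ric}_{g_0}-\frac{\tau R_{g_0}}{2(n-1)}\,g_0\Big),$$ let $\sigma_j$ be the $j$-th elementary symmetric polynomial ($\sigma_0=1$), and let $\Gamma_j=\{\lambda\in\mathbb R^n:\sigma_i(\lambda)>0,\ 1\le i\le j\}$. For a symmetric $2$-tensor $T$ let $\lambda(T)$ denote the eigenvalues of $g_0^{-1}T$ and $\sigma_j(T)=\sigma_j(\lambda(T))$. For $t\in[0,1]$ and $u\in C^\infty(M)$ put $$U^t=\nabla^2u+\frac{1-\tau}{n-2}\,\Delta u\,g_0+\frac{2-\tau}{2}|\nabla u|^2g_0-du\otimes du-tA^{\tau}_{g_0}+(1-t)g_0,$$ with $\nabla$, $\Delta$, $|\cdot|$ taken with respect to $g_0$, and let $c=\sigma_k(e)/\sum_{l=0}^{k-2}\sigma_l(e)$ with $e=(1,\dots,1)\in\mathbb R^n$. For functions $\alpha,\alpha_0,\dots,\alpha_{k-2}$ on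 $M$ consider the family of equations $$\frac{\sigma_k(U^t)}{\sigma_{k-1}(U^t)}-\frac{\sum_{l=0}^{k-2}\big[(1-t)c+t\alpha_l(x)\big]e^{2(k-l)u}\,\sigma_l(U^t)}{\sigma_{k-1}(U^t)}=-t\,\alpha(x)\,e^{2u}\qquad(\ast)_t$$ on $M$. Assume that $\tau<1$ and that $\lambda(-A^{\tau}_{g_0})\in\Gamma_k$ at every point of $M$. Let $K\in\mathbb R$, $L_0,\dots,L_{k-2}\in\mathbb R$ and $m_0,\dots,m_{k-2}>0$. Then there is a constant $C$, depending only on $(M,g_0)$, $k$, $\tau$, $K$, the $L_l$ and the $m_l$, such that the following holds. Let $\alpha,\alpha_0,\dots,\alpha_{k-2}\in C^\infty(M)$ satisfy $\|\alpha\|_{C^0(M)}\le K$, $\|\alpha_l\|_{C^0(M)}\le L_l$ and $\inf_M\alpha_l\ge m_l$ for $0\le l\le k-2$ (in particular, $\alpha_l>0$). Then for every $t\in[0,1]$ and every $u\in C^\infty(M)$ that solves $(\ast)_t$ and satisfies $\lambda(U^t)\in\Gamma_{k-1}$ at every point of $M$, $$\sup_M|u|\le C.$$ -/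

import Mathlib

open Bundle
open scoped Manifold ContDiff

noncomputable section

namespace KrylovSchouten

/-! ### Symmetric functions of eigenvalues -/

/-- The eigenvalues of a real square matrix, repeated according to algebraic multiplicity
(the real roots of its characteristic polynomial).  The matrices below have the form `G⁻¹ * T`
with `G` positive definite and `T` symmetric, so all their eigenvalues are real. -/
def eigenvalues {n : ℕ} (P : Matrix (Fin n) (Fin n) ℝ) : Multiset ℝ :=
  P.charpoly.roots

/-- The elementary symmetric polynomial `σ_j` of a finite family of real numbers (`σ_0 = 1`). -/
def sigma (j : ℕ) (s : Multiset ℝ) : ℝ := s.esymm j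

/-- The cone `Γ_k`: all of `σ_1, …, σ_k` are positive. -/
def InGamma (k : ℕ) (s : Multiset ℝ) : Prop :=
  ∀ j : ℕ, 1 ≤ j → j ≤ k → 0 < sigma j s

/-! ### Riemannian geometry in a chart -/

/-- The model space `ℝⁿ`. -/
abbrev Euc (n : ℕ) : Type := EuclideanSpace ℝ (Fin n)

/-- The partial derivative `∂_i f` on `ℝⁿ`. -/
def pd {n : ℕ} (i : Fin n) (f : Euc n → ℝ) (y : Euc n) : ℝ :=
  fderiv ℝ f y (EuclideanSpace.single i 1)

/-- Smooth Riemannian metrics on an `n`-dimensional manifold `M` without boundary. -/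
abbrev SmoothMetric (n : ℕ) (M : Type*) [TopologicalSpace M] [ChartedSpace (Euc n) M]
    [IsManifold (𝓡 n) ∞ M] : Type _ :=
  ContMDiffRiemannianMetric (𝓡 n) ∞ (Euc n) (fun x : M => TangentSpace (𝓡 n) x)

section Chart

variable {n : ℕ} {M : Type*} [TopologicalSpace M] [ChartedSpace (Euc n) M]
  [IsManifold (𝓡 n) ∞ M]

/-- The coordinate vector `∂/∂x_i` of the chart `e`, at the point with coordinates `y`. -/
def coordVec (e : OpenPartialHomeomorph M (Euc n)) (i : Fin n) (y : Euc n) :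
    TangentSpace (𝓡 n) (e.symm y) :=
  mfderiv (𝓡 n) (𝓡 n) e.symm y (EuclideanSpace.single i (1 : ℝ) : Euc n)

variable (g : SmoothMetric n M) (e : OpenPartialHomeomorph M (Euc n))

/-- The components `g_ij = g(∂_i, ∂_j)` of the metric in the chart `e`. -/
def metricMat (y : Euc n) : Matrix (Fin n) (Fin n) ℝ :=
  Matrix.of fun i j => g.inner (e.symm y) (coordVec e i y) (coordVec e j y)

/-- The components `g^ij` of the inverse metric. -/
def invMetricMat (y : Euc n) : Matrix (Fin n) (Fin n) ℝ := (metricMat g e y)⁻¹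

/-- Christoffel symbols of the Levi-Civita connection:
`Γ^m_ij = ½ g^{ml} (∂_i g_jl + ∂_j g_il - ∂_l g_ij)`. -/
def christoffel (m i j : Fin n) (y : Euc n) : ℝ :=
  (1 / 2) * ∑ l, invMetricMat g e y m l *
    (pd i (fun z => metricMat g e z j l) y + pd j (fun z => metricMat g e z i l) y
      - pd l (fun z => metricMat g e z i j) y)

/-- Ricci curvature (positive on round spheres):
`R_ij = ∂_m Γ^m_ij - ∂_j Γ^m_im + Γ^m_ml Γ^l_ij - Γ^m_jl Γ^l_im`. -/
def ricciMat (y : Euc n) : Matrix (Fin n) (Fin n) ℝ :=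
  Matrix.of fun i j =>
    ∑ m, (pd m (christoffel g e m i j) y - pd j (christoffel g e m i m) y)
    + ∑ m, ∑ l, (christoffel g e m m l y * christoffel g e l i j y
        - christoffel g e m j l y * christoffel g e l i m y)

/-- Scalar curvature `R = g^ij R_ij`. -/
def scalarCurv (y : Euc n) : ℝ :=
  ∑ i, ∑ j, invMetricMat g e y i j * ricciMat g e y i j

/-- The modified Schouten tensor
`A^τ = (1/(n-2)) (Ric - (τ R / (2(n-1))) g)`. -/
def schoutenMat (τ : ℝ) (y : Euc n) : Matrix (Fin n) (Fin n) ℝ :=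
  (1 / ((n : ℝ) - 2)) •
    (ricciMat g e y - (τ * scalarCurv g e y / (2 * ((n : ℝ) - 1))) • metricMat g e y)

/-- The partial derivatives `u_i` of a function `u` on `M` in the chart `e`. -/
def du (u : M → ℝ) (i : Fin n) (y : Euc n) : ℝ := pd i (fun z => u (e.symm z)) y

/-- The Hessian `(∇²u)_ij = ∂_i ∂_j u - Γ^m_ij ∂_m u`. -/
def hessMat (u : M → ℝ) (y : Euc n) : Matrix (Fin n) (Fin n) ℝ :=
  Matrix.of fun i j => pd i (du e u j) y - ∑ m, christoffel g e m i j y * du e u m y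

/-- The Laplacian `Δu = g^ij (∇²u)_ij`. -/
def lap (u : M → ℝ) (y : Euc n) : ℝ :=
  ∑ i, ∑ j, invMetricMat g e y i j * hessMat g e u y i j

/-- `|∇u|² = g^ij u_i u_j`. -/
def gradSq (u : M → ℝ) (y : Euc n) : ℝ :=
  ∑ i, ∑ j, invMetricMat g e y i j * (du e u i y * du e u j y)

/-- The symmetric 2-tensor
`U^t = ∇²u + ((1-τ)/(n-2)) Δu g + ((2-τ)/2)|∇u|² g - du ⊗ du - t A^τ + (1-t) g`. -/
def Umat (τ t : ℝ) (u : M → ℝ) (y : Euc n) : Matrix (Fin n) (Fin n) ℝ :=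
  hessMat g e u y
    + ((1 - τ) / ((n : ℝ) - 2) * lap g e u y) • metricMat g e y
    + ((2 - τ) / 2 * gradSq g e u y) • metricMat g e y
    - Matrix.of (fun i j => du e u i y * du e u j y)
    - t • schoutenMat g e τ y
    + (1 - t) • metricMat g e y

/-- `λ(-A^τ_g)` at `x`: the eigenvalues of `g⁻¹ · (-A^τ_g)`, computed in the chart `e`. -/
def lambdaNegSchouten (τ : ℝ) (x : M) : Multiset ℝ :=
  eigenvalues (invMetricMat g e (e x) * (-schoutenMat g e τ (e x)))

/-- `λ(U^t)` at `x`: the eigenvalues of `g⁻¹ · U^t`, computed in the chart `e`. -/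
def lambdaU (τ t : ℝ) (u : M → ℝ) (x : M) : Multiset ℝ :=
  eigenvalues (invMetricMat g e (e x) * Umat g e τ t u (e x))

end Chart

/-! ### The family of equations -/

/-- `c = σ_k(1,…,1) / ∑_{l=0}^{k-2} σ_l(1,…,1)`, with `n` ones. -/
def cConst (n k : ℕ) : ℝ :=
  sigma k (Multiset.replicate n 1) /
    ∑ l ∈ Finset.range (k - 1), sigma l (Multiset.replicate n 1)

variable {n : ℕ} {M : Type*} [TopologicalSpace M] [ChartedSpace (Euc n) M]
  [IsManifold (𝓡 n) ∞ M]

/-- `λ(-A^τ_g) ∈ Γ_k` at every point of `M` (in all charts of the atlas; the eigenvalues do not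
depend on the chart, as `A^τ_g` and `g` are tensors). -/
def NegSchoutenInGamma (g : SmoothMetric n M) (τ : ℝ) (k : ℕ) : Prop :=
  ∀ e ∈ atlas (Euc n) M, ∀ x ∈ e.source, InGamma k (lambdaNegSchouten g e τ x)

/-- `λ(U^t) ∈ Γ_j` at every point of `M` (in all charts of the atlas). -/
def UInGamma (g : SmoothMetric n M) (τ t : ℝ) (u : M → ℝ) (j : ℕ) : Prop :=
  ∀ e ∈ atlas (Euc n) M, ∀ x ∈ e.source, InGamma j (lambdaU g e τ t u x)

/-- `u` solves, at every point of `M` (in all charts of the atlas), the equation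
`σ_k(U^t)/σ_{k-1}(U^t)
  - (∑_{l=0}^{k-2} [(1-t)c + t α_l] e^{2(k-l)u} σ_l(U^t)) / σ_{k-1}(U^t) = - t α e^{2u}`. -/
def SolvesFamily (g : SmoothMetric n M) (τ : ℝ) (k : ℕ) (α : M → ℝ) (αl : ℕ → M → ℝ)
    (t : ℝ) (u : M → ℝ) : Prop :=
  ∀ e ∈ atlas (Euc n) M, ∀ x ∈ e.source,
    sigma k (lambdaU g e τ t u x) / sigma (k - 1) (lambdaU g e τ t u x)
      - (∑ l ∈ Finset.range (k - 1),
          ((1 - t) * cConst n k + t * αl l x) * Real.exp (2 * ((k : ℝ) - (l : ℝ)) * u x)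
            * sigma l (lambdaU g e τ t u x)) / sigma (k - 1) (lambdaU g e τ t u x)
      = -(t * α x * Real.exp (2 * u x))

end KrylovSchouten

end

/-! ### Newton's inequality and the cones Γ_k for finite families of reals. -/

namespace KrylovSchouten

/-! The bound is a maximum principle argument at the extrema of u. There du = 0, so U^t = -tA^τ +
(1-t)g + P with P = ∇²u + ((1-τ)/(n-2)) Δu g. Since τ < 1, P is negative semidefinite at a maximum
and positive semidefinite at a minimum. Multiplied by σ_{k-1} > 0, the equation reads Σ_l β_l
e^{2(k-l)u} σ_l = σ_k + tα e^{2u} σ_{k-1} with β_l = (1-t)c + tα_l, which lies between positive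
constants.

At a maximum the trace of U^t is bounded above. Since k ≥ 3, U^t lies in Γ_2, and σ_1² = 2σ_2 +
Σλ_i² bounds all eigenvalues, hence all σ_j. The term l = 0, of size e^{2ku}, is then at most C(1 +
e^{2u}), which bounds u above (`exists_upper_bound`).

At a minimum, openness of Γ_k gives a local δ > 0 with -A^τ - δg in Γ_k (`exists_local_bounds`).
Since Γ_k is stable under adding positive semidefinite matrices (`InGamma.add_posSemidef`), U^t - δg
lies in Γ_k. The shift by δ makes σ_k(U^t) dominate every σ_l(U^t), l ≤ k (`exists_esymm_le`). For u
< 0 the equation becomes σ_k ≤ C e^{2u} σ_k, which bounds u below (`exists_lower_bound`).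

Stability of Γ_k rests on Newton's inequality (`esymm_mul_esymm_le`), through the fact that deleting
an entry sends Γ_{k+1} to Γ_k (`InGamma.of_cons`), applied to rank-one perturbations. Compactness of
M makes the local constants global. -/

open Polynomial in
theorem splits_derivative {p : ℝ[X]} (hp : p.Splits) : (derivative p).Splits := by
  rw [splits_iff_card_roots] at hp ⊢
  -- Rolle, counted with multiplicity: p has at most one more root than p', so p' has as many roots
  -- as its degree.
  have h1 := card_roots_le_derivative p
  have h2 := natDegree_derivative_le p
  have h3 := card_roots' (derivative p)
  omega

open Polynomial in
theorem splits_iterate_derivative {p : ℝ[X]} (hp : p.Splits) (m : ℕ) :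
    (derivative^[m] p).Splits := by
  induction m with
  | zero => exact hp
  | succ m ih => rw [Function.iterate_succ_apply']; exact splits_derivative ih

open Polynomial in
/-- Laguerre's inequality for a product of linear factors. -/
theorem laguerre_prod (s : Multiset ℝ) (x : ℝ) :
    let p := (s.map fun r => X - C r).prod
    p.eval x * (derivative (derivative p)).eval x ≤ (derivative p).eval x ^ 2 := by
  induction s using Multiset.induction with
  | empty => simp
  | cons a s ih =>
    simp only [Multiset.map_cons, Multiset.prod_cons, derivative_mul, derivative_sub,
      derivative_X, derivative_C, sub_zero, one_mul, map_add, eval_add, eval_mul, eval_sub,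
      eval_X, eval_C] at ih ⊢
    set p := (s.map fun r => X - C r).prod
    -- For q = (X - a)p one has q'² - q q'' = p² + (x - a)²(p'² - p p'').
    nlinarith [mul_le_mul_of_nonneg_left ih (sq_nonneg (x - a)), sq_nonneg (p.eval x)]

open Polynomial in
theorem laguerre {p : ℝ[X]} (hp : p.Splits) (x : ℝ) :
    p.eval x * (derivative (derivative p)).eval x ≤ (derivative p).eval x ^ 2 := by
  have h := laguerre_prod p.roots x
  rw [hp.eq_prod_roots]
  simp only [derivative_mul, derivative_C, zero_mul, zero_add, eval_mul, eval_C] at h ⊢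
  nlinarith [mul_le_mul_of_nonneg_left h (sq_nonneg p.leadingCoeff)]

open Polynomial in
/-- A weak form of Newton's inequality for the coefficients of a real-rooted polynomial. -/
theorem coeff_mul_coeff_le {p : ℝ[X]} (hp : p.Splits) (m : ℕ) :
    p.coeff m * p.coeff (m + 2) ≤ p.coeff (m + 1) ^ 2 := by
  -- At 0 the derivatives of order m, m+1, m+2 are factorial multiples of the coefficients.
  -- Cancelling (m!)²(m+1) leaves the factors m+2 and m+1, and the larger one is on the favourable
  -- side.
  have h := laguerre (splits_iterate_derivative hp m) 0
  rw [← Function.iterate_succ_apply' derivative m p,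
    ← Function.iterate_succ_apply' derivative (m + 1) p, ← coeff_zero_eq_eval_zero, ← coeff_zero_eq_eval_zero, ← coeff_zero_eq_eval_zero] at h
  simp only [coeff_iterate_derivative, zero_add, Nat.descFactorial_self, nsmul_eq_mul,
    Nat.succ_eq_add_one, Nat.factorial_succ, Nat.cast_mul] at h
  have hf : (0 : ℝ) < (m.factorial : ℝ) := by positivity
  push_cast at h
  have h' : ((m : ℝ) + 2) * (p.coeff m * p.coeff (m + 2)) ≤
      ((m : ℝ) + 1) * p.coeff (m + 1) ^ 2 := by
    have hpos : (0 : ℝ) < (m.factorial : ℝ) ^ 2 * (m + 1) := by positivity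
    rw [← mul_le_mul_iff_right₀ hpos]
    linarith
  by_contra! hlt
  have : (0 : ℝ) ≤ m := m.cast_nonneg
  nlinarith [sq_nonneg (p.coeff (m + 1))]

theorem esymm_cons_succ (a : ℝ) (s : Multiset ℝ) (j : ℕ) :
    (a ::ₘ s).esymm (j + 1) = s.esymm (j + 1) + a * s.esymm j := by
  simp [Multiset.esymm, Multiset.powersetCard_cons, Multiset.sum_map_mul_left]

theorem esymm_zero (s : Multiset ℝ) : s.esymm 0 = 1 := by
  simp [Multiset.esymm]

theorem esymm_eq_zero_of_card_lt {s : Multiset ℝ} {j : ℕ} (h : s.card < j) : s.esymm j = 0 := by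
  simp [Multiset.esymm, Multiset.powersetCard_eq_empty j h]

open Polynomial in
/-- A weak form of Newton's inequality for elementary symmetric functions of real numbers. -/
theorem esymm_mul_esymm_le (s : Multiset ℝ) (j : ℕ) :
    s.esymm j * s.esymm (j + 2) ≤ s.esymm (j + 1) ^ 2 := by
  rcases lt_or_ge s.card (j + 2) with h | h
  · rw [esymm_eq_zero_of_card_lt h, mul_zero]
    positivity
  · have hs : (s.map fun r => X + C r).prod.Splits := by
      refine Splits.multisetProd fun f hf => ?_
      obtain ⟨r, -, rfl⟩ := Multiset.mem_map.1 hf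
      exact Splits.X_add_C r
    have := coeff_mul_coeff_le hs (s.card - (j + 2))
    rw [Multiset.prod_X_add_C_coeff s (by omega), Multiset.prod_X_add_C_coeff s (by omega),
      Multiset.prod_X_add_C_coeff s (by omega)] at this
    rw [show s.card - (s.card - (j + 2)) = j + 2 by omega,
      show s.card - (s.card - (j + 2) + 2) = j by omega,
      show s.card - (s.card - (j + 2) + 1) = j + 1 by omega] at this
    linarith

theorem InGamma.esymm_pos {k : ℕ} {s : Multiset ℝ} (h : InGamma k s) {j : ℕ} (hj : j ≤ k) :
    0 < s.esymm j := by
  rcases Nat.eq_zero_or_pos j with rfl | h0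
  · simp [esymm_zero]
  · exact h j h0 hj

theorem InGamma.mono {k l : ℕ} {s : Multiset ℝ} (h : InGamma k s) (hl : l ≤ k) : InGamma l s :=
  fun j h1 h2 => h j h1 (h2.trans hl)

/-- Deleting an entry maps `Γ_{k+1}` into `Γ_k`. -/
theorem InGamma.of_cons {k : ℕ} {a : ℝ} {s : Multiset ℝ} (h : InGamma (k + 1) (a ::ₘ s)) :
    InGamma k s := by
  have key : ∀ j : ℕ, j ≤ k → 0 < s.esymm j := by
    intro j
    induction j with
    | zero => intro _; simp [esymm_zero]
    | succ j ih =>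
      intro hj
      have h0 := ih (by omega)
      by_contra! hneg
      -- If σ_{j+1}(s) ≤ 0 < σ_j(s), `h1` forces a σ_j > -σ_{j+1} ≥ 0, and `h2` gives σ_{j+2} > -a
      -- σ_{j+1}. Together they yield σ_j σ_{j+2} > σ_{j+1}², against Newton.
      have h1 : 0 < s.esymm (j + 1) + a * s.esymm j := by
        rw [← esymm_cons_succ]; exact h.esymm_pos (by omega)
      have h2 : 0 < s.esymm (j + 2) + a * s.esymm (j + 1) := by
        rw [← esymm_cons_succ]; exact h.esymm_pos (by omega)
      have hN := esymm_mul_esymm_le s j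
      nlinarith [mul_pos h0 h2, mul_nonneg (neg_nonneg.2 hneg) h1.le]
  exact fun j _ hj => key j hj

open Polynomial in
/-- The elementary symmetric functions of a translated family. -/
theorem esymm_map_add (s : Multiset ℝ) (b : ℝ) {j : ℕ} (hj : j ≤ s.card) :
    (s.map (· + b)).esymm j = ∑ i ∈ Finset.range (s.card + 1),
      s.esymm i * (b ^ (j - i) * ((s.card - i).choose (s.card - j) : ℝ)) := by
  have h1 : ((s.map (· + b)).map fun r => X + C r).prod =
      ((s.map fun r => X + C r).prod).comp (X + C b) := by
    rw [multiset_prod_comp]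
    simp only [Multiset.map_map]
    congr 1
    refine Multiset.map_congr rfl fun r _ => ?_
    simp only [Function.comp, add_comp, X_comp, C_comp, C_add]
    ring
  have h2 := congrArg (fun p : ℝ[X] => p.coeff (s.card - j)) h1
  rw [Multiset.prod_X_add_C_coeff _ (by simp), Multiset.card_map,
    show s.card - (s.card - j) = j by omega, Multiset.prod_X_add_C_eq_sum_esymm,
    ← coe_compRingHom_apply, map_sum, finsetSum_coeff] at h2
  rw [h2]
  refine Finset.sum_congr rfl fun i hi => ?_
  rw [coe_compRingHom_apply, mul_comp, C_comp, X_pow_comp, coeff_C_mul, coeff_X_add_C_pow]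
  rw [show s.card - i - (s.card - j) = j - i by have := Finset.mem_range.1 hi; omega]

theorem esymm_map_mul (s : Multiset ℝ) (a : ℝ) (j : ℕ) :
    (s.map (a * ·)).esymm j = a ^ j * s.esymm j := by
  simpa using (Multiset.pow_smul_esymm a j s).symm

theorem choose_sub_pos {N i j : ℕ} (hij : i ≤ j) :
    0 < (N - i).choose (N - j) := Nat.choose_pos (by omega)

/-- Nonnegative combinations of an element of `Γ_k` and of `(1, …, 1)`. -/
theorem InGamma.map_mul_add {k : ℕ} {s : Multiset ℝ} (h : InGamma k s) (hk : k ≤ s.card)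
    {a b : ℝ} (ha : 0 ≤ a) (hb : 0 ≤ b) (hab : 0 < a + b) :
    InGamma k (s.map fun x => a * x + b) := by
  intro j h1 hj
  have e : s.map (fun x => a * x + b) = (s.map (a * ·)).map (· + b) := by
    rw [Multiset.map_map]; rfl
  rw [sigma, e, esymm_map_add _ _ (by rw [Multiset.card_map]; omega), Multiset.card_map]
  simp only [esymm_map_mul]
  have hnn : ∀ i ∈ Finset.range (s.card + 1), 0 ≤ a ^ i * s.esymm i *
      (b ^ (j - i) * ((s.card - i).choose (s.card - j) : ℝ)) := by
    intro i hi
    rcases le_or_gt i j with hij | hij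
    · have := (h.esymm_pos (hij.trans hj)).le
      positivity
    -- For i > j the truncated exponent j - i is 0, but the binomial coefficient vanishes, so these
    -- terms drop out.
    · rw [Nat.choose_eq_zero_of_lt (by have := Finset.mem_range.1 hi; omega)]
      simp
  rcases ha.eq_or_lt with rfl | ha
  · refine Finset.sum_pos' hnn ⟨0, by simp, ?_⟩
    have := choose_sub_pos (N := s.card) (Nat.zero_le j)
    have hb : 0 < b := by linarith
    rw [esymm_zero]
    positivity
  · refine Finset.sum_pos' hnn ⟨j, by simp; omega, ?_⟩
    have := choose_sub_pos (N := s.card) (le_refl j)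
    have := h.esymm_pos hj
    rw [Nat.sub_self, pow_zero]
    positivity

/-- On `Γ_k` shifted by a positive multiple of `(1, …, 1)`, `σ_k` controls every `σ_l`, `l ≤ k`. -/
theorem exists_esymm_le (N k : ℕ) (hk : k ≤ N) {b : ℝ} (hb : 0 < b) :
    ∃ C : ℝ, 0 ≤ C ∧ ∀ s : Multiset ℝ, s.card = N → InGamma k s → ∀ l ≤ k,
      (s.map (· + b)).esymm l ≤ C * (s.map (· + b)).esymm k := by
  refine ⟨∑ l ∈ Finset.range (k + 1), ∑ i ∈ Finset.range (N + 1),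
    ((N - i).choose (N - l) : ℝ) / b ^ (k - l), by positivity, ?_⟩
  rintro s rfl h l hl
  have hnn : ∀ i ∈ Finset.range (s.card + 1), 0 ≤ s.esymm i *
      (b ^ (k - i) * ((s.card - i).choose (s.card - k) : ℝ)) := by
    intro i hi
    rcases le_or_gt i k with hij | hij
    · have := (h.esymm_pos hij).le
      positivity
    · rw [Nat.choose_eq_zero_of_lt (by have := Finset.mem_range.1 hi; omega)]
      simp
  have hk0 : 0 ≤ (s.map (· + b)).esymm k := by
    rw [esymm_map_add _ _ hk]; exact Finset.sum_nonneg hnn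
  -- All terms of the expansion of σ_k are nonnegative with binomial factor at least 1 for i ≤ k, so
  -- σ_k dominates each of them. The expansion of σ_l uses the same σ_i(s), with b^(l-i) = b^(k-i) /
  -- b^(k-l).
  have hterm : ∀ i ≤ k, s.esymm i * b ^ (k - i) ≤ (s.map (· + b)).esymm k := by
    intro i hi
    rw [esymm_map_add _ _ hk]
    refine le_trans ?_ (Finset.single_le_sum hnn (Finset.mem_range.2 (by omega : i < s.card + 1)))
    have h1 : (1 : ℝ) ≤ ((s.card - i).choose (s.card - k) : ℝ) := by
      exact_mod_cast choose_sub_pos hi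
    have h2 := mul_nonneg (h.esymm_pos hi).le (pow_nonneg hb.le (k - i))
    nlinarith
  have hl' : (s.map (· + b)).esymm l ≤ (∑ i ∈ Finset.range (s.card + 1),
      ((s.card - i).choose (s.card - l) : ℝ) / b ^ (k - l)) * (s.map (· + b)).esymm k := by
    rw [esymm_map_add s b (hl.trans hk), Finset.sum_mul]
    refine Finset.sum_le_sum fun i hi => ?_
    rcases le_or_gt i l with hij | hij
    · have e : b ^ (k - i) = b ^ (l - i) * b ^ (k - l) := by
        rw [← pow_add]; congr 1; omega
      have := hterm i (hij.trans hl)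
      rw [div_mul_eq_mul_div, le_div_iff₀ (by positivity)]
      rw [e] at this
      calc s.esymm i * (b ^ (l - i) * ((s.card - i).choose (s.card - l) : ℝ)) * b ^ (k - l)
          = ((s.card - i).choose (s.card - l) : ℝ) *
            (s.esymm i * (b ^ (l - i) * b ^ (k - l))) := by ring
        _ ≤ _ := by gcongr
    · rw [Nat.choose_eq_zero_of_lt (by have := Finset.mem_range.1 hi; omega)]
      simp
  refine hl'.trans (mul_le_mul_of_nonneg_right ?_ hk0)
  exact Finset.single_le_sum (f := fun l => ∑ i ∈ Finset.range (s.card + 1),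
    ((s.card - i).choose (s.card - l) : ℝ) / b ^ (k - l)) (fun _ _ => by positivity)
    (Finset.mem_range.2 (by omega : l < k + 1))

theorem esymm_one_sq (s : Multiset ℝ) :
    s.esymm 1 ^ 2 = 2 * s.esymm 2 + (s.map (· ^ 2)).sum := by
  induction s using Multiset.induction with
  | empty =>
    rw [esymm_eq_zero_of_card_lt (j := 1) (by simp), esymm_eq_zero_of_card_lt (j := 2) (by simp)]
    simp
  | cons a s ih =>
    rw [esymm_cons_succ a s 0, esymm_cons_succ a s 1, esymm_zero, Multiset.map_cons,
      Multiset.sum_cons, add_sq, zero_add, ih]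
    ring

theorem abs_esymm_le {T : ℝ} (hT : 0 ≤ T) (s : Multiset ℝ) (hs : ∀ x ∈ s, |x| ≤ T) (j : ℕ) :
    |s.esymm j| ≤ s.card.choose j * T ^ j := by
  induction s using Multiset.induction generalizing j with
  | empty =>
    cases j with
    | zero => simp [esymm_zero]
    | succ j => rw [esymm_eq_zero_of_card_lt (by simp)]; simp
  | cons a s ih =>
    cases j with
    | zero => simp [esymm_zero]
    | succ j =>
      have hs' : ∀ x ∈ s, |x| ≤ T := fun x hx => hs x (Multiset.mem_cons_of_mem hx)
      rw [esymm_cons_succ, Multiset.card_cons, Nat.choose_succ_succ]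
      calc |s.esymm (j + 1) + a * s.esymm j|
          ≤ |s.esymm (j + 1)| + |a| * |s.esymm j| := by
            rw [← abs_mul]; exact abs_add_le _ _
        _ ≤ s.card.choose (j + 1) * T ^ (j + 1) + T * (s.card.choose j * T ^ j) := by
            gcongr
            · exact ih hs' _
            · exact hs a (Multiset.mem_cons_self a s)
            · exact ih hs' _
        _ = _ := by push_cast; ring

/-- On `Γ_2`, an upper bound of `σ_1` bounds every `|σ_j|`. -/
theorem exists_abs_esymm_le (N j : ℕ) (T : ℝ) :
    ∃ C : ℝ, 0 ≤ C ∧ ∀ s : Multiset ℝ, s.card = N → InGamma 2 s → s.esymm 1 ≤ T →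
      |s.esymm j| ≤ C := by
  refine ⟨N.choose j * |T| ^ j, by positivity, ?_⟩
  rintro s rfl h hT
  refine abs_esymm_le (abs_nonneg T) s (fun x hx => ?_) j
  have h1 := h.esymm_pos one_le_two
  have h2 := h.esymm_pos le_rfl
  have h3 : x ^ 2 ≤ (s.map (· ^ 2)).sum :=
    Multiset.single_le_sum (fun y hy => by
      obtain ⟨z, -, rfl⟩ := Multiset.mem_map.1 hy
      positivity) _ (Multiset.mem_map_of_mem _ hx)
  have h4 := esymm_one_sq s
  -- x² ≤ Σλ_i² = σ_1² - 2σ_2 ≤ T², since σ_2 > 0 and 0 < σ_1 ≤ T.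
  exact sq_le_sq.1 (by nlinarith)

end KrylovSchouten

/-! ### Spectra of G⁻¹T and stability of Γ_k under positive perturbations. -/

namespace KrylovSchouten

open Matrix

variable {n : ℕ}

open scoped MatrixOrder in
theorem exists_congr_one {G : Matrix (Fin n) (Fin n) ℝ} (hG : G.PosDef) :
    ∃ Q : Matrix (Fin n) (Fin n) ℝ, Qᵀ * G * Q = 1 := by
  obtain ⟨y, rfl⟩ := CStarAlgebra.nonneg_iff_eq_star_mul_self.mp hG.posSemidef.nonneg
  have hy : IsUnit y.det := by
    have := hG.isUnit
    rw [isUnit_iff_isUnit_det, det_mul] at this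
    exact isUnit_of_mul_isUnit_right this
  refine ⟨y⁻¹, ?_⟩
  rw [star_eq_conjTranspose, conjTranspose_eq_transpose_of_trivial, ← Matrix.mul_assoc,
    ← transpose_mul, mul_nonsing_inv _ hy, transpose_one, Matrix.one_mul, mul_nonsing_inv _ hy]

theorem inv_eq_of_congr_one {G Q : Matrix (Fin n) (Fin n) ℝ} (hQ : Qᵀ * G * Q = 1) :
    G⁻¹ = Q * Qᵀ := by
  refine inv_eq_right_inv ?_
  rw [Matrix.mul_assoc, mul_eq_one_comm] at hQ
  rw [← Matrix.mul_assoc, hQ]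

/-- G⁻¹ = QQᵀ, and AB and BA have the same characteristic polynomial. This replaces the
non-symmetric G⁻¹T by a matrix that is symmetric when T is. -/
theorem charpoly_inv_mul {G Q : Matrix (Fin n) (Fin n) ℝ} (hQ : Qᵀ * G * Q = 1)
    (T : Matrix (Fin n) (Fin n) ℝ) : (G⁻¹ * T).charpoly = (Qᵀ * T * Q).charpoly := by
  rw [inv_eq_of_congr_one hQ, Matrix.mul_assoc, charpoly_mul_comm]

/-- Simultaneous diagonalization of a positive definite and a symmetric matrix. -/
theorem exists_congr_diagonal {G T : Matrix (Fin n) (Fin n) ℝ} (hG : G.PosDef)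
    (hT : T.IsHermitian) : ∃ (Q : Matrix (Fin n) (Fin n) ℝ) (d : Fin n → ℝ),
      Qᵀ * G * Q = 1 ∧ Qᵀ * T * Q = diagonal d := by
  obtain ⟨Q, hQ⟩ := exists_congr_one hG
  have hS : (Qᵀ * T * Q).IsHermitian := by
    rw [← conjTranspose_eq_transpose_of_trivial]
    exact isHermitian_conjTranspose_mul_mul Q hT
  have hU := hS.conjStarAlgAut_star_eigenvectorUnitary
  rw [Unitary.conjStarAlgAut_star_apply] at hU
  set O : Matrix (Fin n) (Fin n) ℝ := (hS.eigenvectorUnitary : Matrix (Fin n) (Fin n) ℝ)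
  have hO : Oᵀ * O = 1 := by
    have := Unitary.coe_star_mul_self hS.eigenvectorUnitary
    rwa [star_eq_conjTranspose, conjTranspose_eq_transpose_of_trivial] at this
  rw [star_eq_conjTranspose, conjTranspose_eq_transpose_of_trivial] at hU
  refine ⟨Q * O, hS.eigenvalues, ?_, ?_⟩
  · calc (Q * O)ᵀ * G * (Q * O) = Oᵀ * (Qᵀ * G * Q) * O := by
          simp only [transpose_mul, Matrix.mul_assoc]
      _ = 1 := by rw [hQ, Matrix.mul_one, hO]
  · calc (Q * O)ᵀ * T * (Q * O) = Oᵀ * (Qᵀ * T * Q) * O := by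
          simp only [transpose_mul, Matrix.mul_assoc]
      _ = _ := hU

theorem charpoly_of_congr_diagonal {G T Q : Matrix (Fin n) (Fin n) ℝ} {d : Fin n → ℝ}
    (hQ : Qᵀ * G * Q = 1) (hT : Qᵀ * T * Q = diagonal d) :
    (G⁻¹ * T).charpoly = ∏ i, (Polynomial.X - Polynomial.C (d i)) := by
  rw [charpoly_inv_mul hQ, hT, charpoly_diagonal]

theorem eigenvalues_of_congr_diagonal {G T Q : Matrix (Fin n) (Fin n) ℝ} {d : Fin n → ℝ}
    (hQ : Qᵀ * G * Q = 1) (hT : Qᵀ * T * Q = diagonal d) :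
    eigenvalues (G⁻¹ * T) = Finset.univ.val.map d := by
  rw [eigenvalues, charpoly_of_congr_diagonal hQ hT, ← Polynomial.roots_multiset_prod_X_sub_C
      (Finset.univ.val.map d), Multiset.map_map]
  rfl

theorem card_eigenvalues {G T : Matrix (Fin n) (Fin n) ℝ} (hG : G.PosDef) (hT : T.IsHermitian) :
    (eigenvalues (G⁻¹ * T)).card = n := by
  obtain ⟨Q, d, hQ, hd⟩ := exists_congr_diagonal hG hT
  simp [eigenvalues_of_congr_diagonal hQ hd]

/-- Vieta, available because all n roots are real. As a charpoly coefficient, σ_j is continuous in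
the matrix and computable after a rank-one perturbation. -/
theorem sigma_eigenvalues {G T : Matrix (Fin n) (Fin n) ℝ} (hG : G.PosDef) (hT : T.IsHermitian)
    {j : ℕ} (hj : j ≤ n) :
    sigma j (eigenvalues (G⁻¹ * T)) = (-1) ^ j * (G⁻¹ * T).charpoly.coeff (n - j) := by
  have hdeg : (G⁻¹ * T).charpoly.natDegree = n := by simp
  have h := Polynomial.coeff_eq_esymm_roots_of_card (p := (G⁻¹ * T).charpoly)
    (by rw [hdeg]; exact card_eigenvalues hG hT) (k := n - j) (by omega)
  rw [h, hdeg, (charpoly_monic _).leadingCoeff, show n - (n - j) = j by omega, one_mul,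
    ← mul_assoc, ← mul_pow]
  simp [sigma, eigenvalues]

theorem eigenvalues_smul_add {G T : Matrix (Fin n) (Fin n) ℝ} (hG : G.PosDef)
    (hT : T.IsHermitian) (a b : ℝ) :
    eigenvalues (G⁻¹ * (a • T + b • G)) = (eigenvalues (G⁻¹ * T)).map fun x => a * x + b := by
  obtain ⟨Q, d, hQ, hd⟩ := exists_congr_diagonal hG hT
  have h : Qᵀ * (a • T + b • G) * Q = diagonal fun i => a * d i + b := by
    rw [Matrix.mul_add, Matrix.add_mul, Matrix.mul_smul, Matrix.mul_smul, Matrix.smul_mul,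
      Matrix.smul_mul, hd, hQ, ← diagonal_one, ← diagonal_smul, ← diagonal_smul, diagonal_add]
    congr 1
    ext i
    simp
  rw [eigenvalues_of_congr_diagonal hQ h, eigenvalues_of_congr_diagonal hQ hd, Multiset.map_map]
  rfl

theorem sigma_one_eigenvalues {G T : Matrix (Fin n) (Fin n) ℝ} (hG : G.PosDef)
    (hT : T.IsHermitian) : sigma 1 (eigenvalues (G⁻¹ * T)) = (G⁻¹ * T).trace := by
  obtain ⟨Q, d, hQ, hd⟩ := exists_congr_diagonal hG hT
  rw [eigenvalues_of_congr_diagonal hQ hd, inv_eq_of_congr_one hQ, Matrix.mul_assoc,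
    trace_mul_comm, hd, trace_diagonal]
  rw [sigma, Finset.esymm_map_val, Finset.powersetCard_one]
  simp

-- The matrix determinant lemma gives the identity at every t outside the finite set of the d_i, and
-- two polynomials agreeing at infinitely many points coincide.
open Polynomial in
theorem charpoly_diagonal_add_vecMulVec (d w : Fin n → ℝ) :
    (diagonal d + vecMulVec w w).charpoly = ∏ i, (X - C (d i)) -
      ∑ i, C (w i ^ 2) * ∏ j ∈ Finset.univ.erase i, (X - C (d j)) := by
  refine Polynomial.eq_of_infinite_eval_eq _ _ ((Set.finite_range d).infinite_compl.mono ?_)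
  intro t ht
  have ht' : ∀ i, t - d i ≠ 0 := fun i h => ht ⟨i, by linarith⟩
  have hdet : IsUnit (diagonal fun i => t - d i).det := by
    rw [det_diagonal]
    exact (Finset.prod_ne_zero_iff.2 fun i _ => ht' i).isUnit
  have hinv : (diagonal fun i => t - d i)⁻¹ = diagonal fun i => (t - d i)⁻¹ := by
    refine inv_eq_right_inv ?_
    rw [diagonal_mul_diagonal, ← diagonal_one]
    congr 1
    ext i
    exact mul_inv_cancel₀ (ht' i)
  have e : scalar (Fin n) t - (diagonal d + vecMulVec w w) =
      (diagonal fun i => t - d i) +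
        replicateCol Unit (-w) * replicateRow Unit w := by
    ext i j
    rcases eq_or_ne i j with rfl | hij
    · simp [vecMulVec_apply, Matrix.mul_apply]; ring
    · simp [vecMulVec_apply, Matrix.mul_apply, hij]
  rw [Set.mem_ofPred_eq]
  rw [eval_charpoly, e, det_add_replicateCol_mul_replicateRow hdet, hinv, det_diagonal,
    det_unique]
  simp only [eval_sub, eval_prod, eval_finsetSum, eval_mul, eval_X, eval_C]
  have hprod : ∀ i, ∏ j ∈ Finset.univ.erase i, (t - d j) =
      (∏ j, (t - d j)) * (t - d i)⁻¹ := by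
    intro i
    rw [← Finset.mul_prod_erase Finset.univ (fun j => t - d j) (Finset.mem_univ i)]
    field_simp [ht' i]
  simp only [hprod]
  simp [Matrix.mul_apply, diagonal_apply, mul_add, Finset.mul_sum, sub_eq_add_neg]
  exact Finset.sum_congr rfl fun i _ => by ring

/-- Adding a rank-one positive matrix preserves `Γ_k`. -/
theorem InGamma.add_vecMulVec {G T : Matrix (Fin n) (Fin n) ℝ} (hG : G.PosDef)
    (hT : T.IsHermitian) {k : ℕ} (hk : k ≤ n) (h : InGamma k (eigenvalues (G⁻¹ * T)))
    (v : Fin n → ℝ) : InGamma k (eigenvalues (G⁻¹ * (T + vecMulVec v v))) := by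
  obtain ⟨Q, d, hQ, hd⟩ := exists_congr_diagonal hG hT
  have hv : (vecMulVec v v).IsHermitian := by
    ext i j
    simp [vecMulVec_apply, mul_comm]
  set w := Qᵀ *ᵥ v
  have hw : Qᵀ * (T + vecMulVec v v) * Q = diagonal d + vecMulVec w w := by
    rw [Matrix.mul_add, Matrix.add_mul, hd, mul_vecMulVec, vecMulVec_mul, ← mulVec_transpose]
  rw [eigenvalues_of_congr_diagonal hQ hd] at h
  intro j hj1 hj
  obtain ⟨j, rfl⟩ : ∃ i, j = i + 1 := ⟨j - 1, by omega⟩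
  have hcard : ∀ i : Fin n, ((Finset.univ.erase i).val.map d).card = n - 1 := by
    intro i
    rw [Multiset.card_map, Finset.card_val, Finset.card_erase_of_mem (Finset.mem_univ i)]
    simp
  have hsplit : ∀ i : Fin n, Finset.univ.val.map d =
      d i ::ₘ (Finset.univ.erase i).val.map d := by
    intro i
    rw [← Multiset.map_cons, Finset.erase_val, Multiset.cons_erase (Finset.mem_univ i)]
  have hco : ∀ i : Fin n, (∏ l ∈ Finset.univ.erase i,
      (Polynomial.X - Polynomial.C (d l))).coeff (n - (j + 1)) =
      (-1) ^ j * ((Finset.univ.erase i).val.map d).esymm j := by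
    intro i
    have := Multiset.prod_X_sub_C_coeff ((Finset.univ.erase i).val.map d)
      (k := n - (j + 1)) (by rw [hcard]; omega)
    rw [hcard, show n - 1 - (n - (j + 1)) = j by omega, Multiset.map_map] at this
    exact this
  have hmain : (∏ l, (Polynomial.X - Polynomial.C (d l))).coeff (n - (j + 1)) =
      (-1) ^ (j + 1) * (Finset.univ.val.map d).esymm (j + 1) := by
    have := Multiset.prod_X_sub_C_coeff (Finset.univ.val.map d)
      (k := n - (j + 1)) (by simp)
    rw [Multiset.card_map, Finset.card_val, Finset.card_univ, Fintype.card_fin,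
      show n - (n - (j + 1)) = j + 1 by omega, Multiset.map_map] at this
    exact this
  rw [sigma_eigenvalues hG (hT.add hv) (hj.trans hk), charpoly_inv_mul hQ, hw,
    charpoly_diagonal_add_vecMulVec, Polynomial.coeff_sub, Polynomial.finsetSum_coeff, hmain]
  simp only [Polynomial.coeff_C_mul, hco]
  -- The perturbed σ_{j+1} equals σ_{j+1}(d) + Σ_i w_i² σ_j(d without d_i); deleting an entry stays
  -- in Γ_j, so the sum is nonnegative.
  have hpos : 0 ≤ ∑ i, w i ^ 2 * ((Finset.univ.erase i).val.map d).esymm j := by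
    refine Finset.sum_nonneg fun i _ => mul_nonneg (sq_nonneg _) ?_
    have h' := h.mono hj
    rw [hsplit i] at h'
    exact (h'.of_cons.esymm_pos le_rfl).le
  have h1 := h.esymm_pos hj
  have hsq : ((-1 : ℝ) ^ j) * (-1) ^ j = 1 := by rw [← mul_pow]; simp
  have e : ∑ i, w i ^ 2 * ((-1) ^ j * ((Finset.univ.erase i).val.map d).esymm j) =
      (-1) ^ j * ∑ i, w i ^ 2 * ((Finset.univ.erase i).val.map d).esymm j := by
    rw [Finset.mul_sum]
    exact Finset.sum_congr rfl fun i _ => by ring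
  rw [e, pow_succ]
  have e2 : (-1 : ℝ) ^ j * -1 * ((-1) ^ j * -1 * (Finset.univ.val.map d).esymm (j + 1) -
      (-1) ^ j * ∑ i, w i ^ 2 * ((Finset.univ.erase i).val.map d).esymm j) =
      (Finset.univ.val.map d).esymm (j + 1) +
        ∑ i, w i ^ 2 * ((Finset.univ.erase i).val.map d).esymm j := by
    linear_combination ((Finset.univ.val.map d).esymm (j + 1) +
      ∑ i, w i ^ 2 * ((Finset.univ.erase i).val.map d).esymm j) * hsq
  rw [e2]
  linarith

/-- Adding a positive semidefinite matrix preserves `Γ_k`. -/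
theorem InGamma.add_posSemidef {G T P : Matrix (Fin n) (Fin n) ℝ} (hG : G.PosDef)
    (hT : T.IsHermitian) {k : ℕ} (hk : k ≤ n) (h : InGamma k (eigenvalues (G⁻¹ * T)))
    (hP : P.PosSemidef) : InGamma k (eigenvalues (G⁻¹ * (T + P))) := by
  -- A positive semidefinite matrix is a sum of rank-one squares, which are added one at a time.
  obtain ⟨m, v, rfl⟩ := posSemidef_iff_eq_sum_vecMulVec.mp hP
  suffices hs : ∀ s : Finset (Fin m), (T + ∑ i ∈ s, vecMulVec (v i) (star (v i))).IsHermitian ∧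
      InGamma k (eigenvalues (G⁻¹ * (T + ∑ i ∈ s, vecMulVec (v i) (star (v i))))) from
    (hs Finset.univ).2
  intro s
  induction s using Finset.induction with
  | empty => simpa using ⟨hT, h⟩
  | insert a s ha ih =>
    rw [Finset.sum_insert ha, add_comm (vecMulVec _ _), ← add_assoc, star_trivial]
    refine ⟨ih.1.add ?_, ih.2.add_vecMulVec hG ih.1 hk (v a)⟩
    ext i j
    simp [vecMulVec_apply, mul_comm]

theorem continuous_charpoly_coeff (j : ℕ) (hj : j ≤ n) :
    Continuous fun P : Matrix (Fin n) (Fin n) ℝ => P.charpoly.coeff (n - j) := by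
  have : ∀ P : Matrix (Fin n) (Fin n) ℝ, P.charpoly.coeff (n - j) =
      (-1) ^ j * ∑ s ∈ Finset.univ.powersetCard j,
        (P.submatrix (Subtype.val : s → Fin n) (Subtype.val : s → Fin n)).det := by
    intro P
    simpa using charpoly_coeff_eq_sum_minors P j (by simpa using hj)
  simp only [this]
  fun_prop

end KrylovSchouten

/-! ### Partial derivatives and the second-order condition on ℝⁿ. -/

namespace KrylovSchouten

open scoped Matrix

section Calculus

variable {n : ℕ} {s : Set (Euc n)}

theorem contDiffOn_pd (hs : IsOpen s) {f : Euc n → ℝ} (hf : ContDiffOn ℝ ∞ f s) (i : Fin n) :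
    ContDiffOn ℝ ∞ (pd i f) s :=
  (hf.fderiv_of_isOpen hs (m := ∞) (by simp)).clm_apply contDiffOn_const

theorem differentiableAt_of_contDiffOn (hs : IsOpen s) {f : Euc n → ℝ}
    (hf : ContDiffOn ℝ ∞ f s) {y : Euc n} (hy : y ∈ s) : DifferentiableAt ℝ f y :=
  (hf.contDiffAt (hs.mem_nhds hy)).differentiableAt (by simp)

theorem pd_congr (hs : IsOpen s) {f g : Euc n → ℝ} (hfg : Set.EqOn f g s) {y : Euc n}
    (hy : y ∈ s) (i : Fin n) : pd i f y = pd i g y := by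
  rw [pd, pd, (hfg.eventuallyEq_of_mem (hs.mem_nhds hy)).fderiv_eq]

theorem pd_const (i : Fin n) (c : ℝ) (y : Euc n) : pd i (fun _ => c) y = 0 := by
  simp [pd]

theorem pd_neg (i : Fin n) (f : Euc n → ℝ) (y : Euc n) :
    pd i (fun z => -f z) y = -pd i f y := by
  simp [pd, fderiv_fun_neg]

theorem pd_sum {ι : Type*} (t : Finset ι) {f : ι → Euc n → ℝ} {y : Euc n}
    (hf : ∀ a ∈ t, DifferentiableAt ℝ (f a) y) (i : Fin n) :
    pd i (fun z => ∑ a ∈ t, f a z) y = ∑ a ∈ t, pd i (f a) y := by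
  simp only [pd]
  rw [fderiv_fun_sum hf, _root_.sum_apply]

theorem pd_mul {f g : Euc n → ℝ} {y : Euc n} (hf : DifferentiableAt ℝ f y)
    (hg : DifferentiableAt ℝ g y) (i : Fin n) :
    pd i (fun z => f z * g z) y = pd i f y * g y + f y * pd i g y := by
  simp only [pd]
  rw [fderiv_fun_mul hf hg]
  simp
  ring

theorem pd_const_mul {f : Euc n → ℝ} {y : Euc n} (hf : DifferentiableAt ℝ f y) (c : ℝ)
    (i : Fin n) : pd i (fun z => c * f z) y = c * pd i f y := by
  rw [pd_mul (by fun_prop) hf, pd_const, zero_mul, zero_add]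

theorem pd_pd {f : Euc n → ℝ} (hs : IsOpen s) (hf : ContDiffOn ℝ ∞ f s) {y : Euc n}
    (hy : y ∈ s) (i j : Fin n) : pd i (pd j f) y =
      fderiv ℝ (fderiv ℝ f) y (EuclideanSpace.single i 1) (EuclideanSpace.single j 1) := by
  have h : DifferentiableAt ℝ (fderiv ℝ f) y :=
    ((hf.fderiv_of_isOpen hs (m := ∞) (by simp)).contDiffAt (hs.mem_nhds hy)).differentiableAt
      (by simp)
  unfold pd
  rw [fderiv_clm_apply h (by fun_prop)]
  simp

theorem pd_comm {f : Euc n → ℝ} (hs : IsOpen s) (hf : ContDiffOn ℝ ∞ f s) {y : Euc n}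
    (hy : y ∈ s) (i j : Fin n) : pd i (pd j f) y = pd j (pd i f) y := by
  rw [pd_pd hs hf hy, pd_pd hs hf hy]
  exact (hf.contDiffAt (hs.mem_nhds hy)).isSymmSndFDerivAt
    (by rw [minSmoothness_of_isRCLikeNormedField]; exact ENat.LEInfty.out) _ _

/-- If f'' were negative at x, the second derivative test would make x a local maximum too, so f
would be locally constant and f'' zero. -/
theorem deriv_deriv_nonneg_of_isLocalMin {f : ℝ → ℝ} {x : ℝ} (h : IsLocalMin f x)
    (hc : ContinuousAt f x) : 0 ≤ deriv (deriv f) x := by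
  by_contra! hneg
  have h' := isLocalMax_of_deriv_deriv_neg hneg h.deriv_eq_zero hc
  have hconst : f =ᶠ[nhds x] fun _ => f x := by
    filter_upwards [h, h'] with z h1 h2
    exact le_antisymm h2 h1
  have := hconst.deriv.deriv_eq
  simp at this
  linarith

theorem pd_eq_zero_of_isLocalExtr {f : Euc n → ℝ} {y : Euc n} (h : IsLocalExtr f y)
    (i : Fin n) : pd i f y = 0 := by
  simp [pd, h.fderiv_eq_zero]

/-- At a local minimum the matrix of second partial derivatives is positive semidefinite. -/
theorem posSemidef_pd_pd_of_isLocalMin {f : Euc n → ℝ} (hs : IsOpen s)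
    (hf : ContDiffOn ℝ ∞ f s) {y : Euc n} (hy : y ∈ s) (h : IsLocalMin f y) :
    (Matrix.of fun i j => pd i (pd j f) y).PosSemidef := by
  refine Matrix.PosSemidef.of_dotProduct_mulVec_nonneg ?_ fun v => ?_
  · ext i j
    simpa using pd_comm hs hf hy j i
  set w : Euc n := WithLp.toLp 2 v
  have hw : w = ∑ i, v i • EuclideanSpace.single i (1 : ℝ) := by
    ext j
    simp [w, Finset.sum_apply, Pi.single_apply]
  have hval : star v ⬝ᵥ ((Matrix.of fun i j => pd i (pd j f) y) *ᵥ v) =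
      fderiv ℝ (fderiv ℝ f) y w w := by
    rw [hw]
    simp only [map_sum, map_smul, _root_.sum_apply, _root_.smul_apply,
      dotProduct, Matrix.mulVec, Matrix.of_apply, pd_pd hs hf hy, smul_eq_mul, star_trivial, Finset.mul_sum]
    rw [Finset.sum_comm]
    exact Finset.sum_congr rfl fun i _ => Finset.sum_congr rfl fun j _ => by ring
  rw [hval]
  -- The quadratic form at w is the second derivative of f along the line through y in direction w.
  set φ : ℝ → ℝ := fun r => f (y + r • w)
  have hline : ∀ r, HasDerivAt (fun r : ℝ => y + r • w) w r := fun r => by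
    simpa using ((hasDerivAt_id r).smul_const w).const_add y
  have hline0 : y + (0 : ℝ) • w = y := by simp
  have hcont : ContinuousAt (fun r : ℝ => y + r • w) 0 := (hline 0).continuousAt
  have hev : ∀ᶠ r in nhds (0 : ℝ), y + r • w ∈ s :=
    hcont.eventually (p := (· ∈ s)) (by
      show ∀ᶠ z in nhds (y + (0 : ℝ) • w), z ∈ s
      rw [hline0]; exact hs.mem_nhds hy)
  have hd : deriv φ =ᶠ[nhds 0] fun r => fderiv ℝ f (y + r • w) w := by
    filter_upwards [hev] with r hr
    exact ((differentiableAt_of_contDiffOn hs hf hr).hasFDerivAt.comp_hasDerivAt r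
      (hline r)).deriv
  have hdd : DifferentiableAt ℝ (fderiv ℝ f) y :=
    ((hf.fderiv_of_isOpen hs (m := ∞) (by simp)).contDiffAt (hs.mem_nhds hy)).differentiableAt
      (by simp)
  have h2 : deriv (deriv φ) 0 = fderiv ℝ (fderiv ℝ f) y w w := by
    rw [hd.deriv_eq]
    have h3 : HasFDerivAt (fun z => fderiv ℝ f z w)
        ((fderiv ℝ (fderiv ℝ f) y).flip w) (y + (0 : ℝ) • w) := by
      rw [hline0]
      exact (ContinuousLinearMap.apply ℝ ℝ w).hasFDerivAt.comp y hdd.hasFDerivAt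
    exact (h3.comp_hasDerivAt (0 : ℝ) (hline 0)).deriv
  rw [← h2]
  refine deriv_deriv_nonneg_of_isLocalMin ?_ ?_
  · have := hcont.tendsto
    rw [hline0] at this
    have := this.eventually h
    simpa [IsLocalMin, IsMinFilter, φ] using this
  · have h5 : ContinuousAt f (y + (0 : ℝ) • w) := by
      rw [hline0]; exact (differentiableAt_of_contDiffOn hs hf hy).continuousAt
    exact ContinuousAt.comp (f := fun r : ℝ => y + r • w) h5 hcont

theorem contDiffOn_det {ι : Type*} [Fintype ι] [DecidableEq ι]
    {A : Euc n → Matrix ι ι ℝ} (hA : ∀ i j, ContDiffOn ℝ ∞ (fun y => A y i j) s) :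
    ContDiffOn ℝ ∞ (fun y => (A y).det) s := by
  simp only [Matrix.det_apply']
  exact ContDiffOn.sum fun σ _ => contDiffOn_const.mul (contDiffOn_prod fun i _ => hA _ _)

theorem contDiffOn_inv {A : Euc n → Matrix (Fin n) (Fin n) ℝ}
    (hA : ∀ i j, ContDiffOn ℝ ∞ (fun y => A y i j) s) (hdet : ∀ y ∈ s, (A y).det ≠ 0)
    (i j : Fin n) : ContDiffOn ℝ ∞ (fun y => (A y)⁻¹ i j) s := by
  simp only [Matrix.inv_def, Ring.inverse_eq_inv', Matrix.smul_apply, smul_eq_mul,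
    Matrix.adjugate_apply]
  refine ((contDiffOn_det hA).inv hdet).mul (contDiffOn_det fun a b => ?_)
  simp only [Matrix.updateRow_apply]
  split_ifs
  · exact contDiffOn_const
  · exact hA a b

end Calculus

end KrylovSchouten

/-! ### Smoothness and symmetry of the curvature tensors in a chart. -/

namespace KrylovSchouten

open scoped Matrix

section Geometry

variable {n : ℕ} {M : Type*} [TopologicalSpace M] [ChartedSpace (Euc n) M]
  [IsManifold (𝓡 n) ∞ M]

/-- The coordinate field is the tangent map of `e.symm` applied to a constant section. -/
theorem contMDiffOn_coordVec {e : OpenPartialHomeomorph M (Euc n)} (he : e ∈ atlas (Euc n) M)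
    (i : Fin n) : ContMDiffOn (𝓡 n) (𝓡 n).tangent ∞
      (fun y => (⟨e.symm y, coordVec e i y⟩ : TangentBundle (𝓡 n) M)) e.target := by
  have hs : ContMDiffOn (𝓡 n) (𝓡 n) ∞ e.symm e.target :=
    contMDiffOn_symm_of_mem_maximalAtlas (IsManifold.subset_maximalAtlas he)
  have hu : UniqueMDiffOn (𝓡 n) e.target := e.open_target.uniqueMDiffOn
  have ht := hs.contMDiffOn_tangentMapWithin (m := ∞) (by simp) hu
  have hsec : ContMDiffOn (𝓡 n) (𝓡 n).tangent ∞
      (fun y : Euc n => (⟨y, (EuclideanSpace.single i (1 : ℝ) : Euc n)⟩ :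
        TangentBundle (𝓡 n) (Euc n))) e.target := by
    intro y _
    refine ContMDiffAt.contMDiffWithinAt ?_
    exact (contMDiffAt_vectorSpace_iff_contDiffAt (𝕜 := ℝ) (E := Euc n) (n := ∞)
      (V := fun _ : Euc n => (EuclideanSpace.single i (1 : ℝ) : Euc n)) (x := y)).2 contDiffAt_const
  have hcomp := ht.comp hsec (fun y hy => hy)
  refine hcomp.congr fun y hy => ?_
  simp only [Function.comp]
  rw [tangentMapWithin_eq_tangentMap (hu y hy)
    ((hs.contMDiffAt (e.open_target.mem_nhds hy)).mdifferentiableAt (by simp))]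
  rfl

variable (g : SmoothMetric n M) {e : OpenPartialHomeomorph M (Euc n)}

theorem contDiffOn_metricMat (he : e ∈ atlas (Euc n) M) (i j : Fin n) :
    ContDiffOn ℝ ∞ (fun y => metricMat g e y i j) e.target := by
  rw [← contMDiffOn_iff_contDiffOn]
  intro y hy
  have hs : ContMDiffAt (𝓡 n) (𝓡 n) ∞ e.symm y :=
    (contMDiffOn_symm_of_mem_maximalAtlas (IsManifold.subset_maximalAtlas he)).contMDiffAt
      (e.open_target.mem_nhds hy)
  have hv := fun i => (contMDiffOn_coordVec he i).contMDiffAt (e.open_target.mem_nhds hy)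
  have h := ContMDiffAt.clm_bundle_apply₂ (F₁ := Euc n) (F₂ := Euc n) (F₃ := ℝ)
    (E₃ := Bundle.Trivial M ℝ) (b := e.symm) (ψ := fun y => g.inner (e.symm y))
    (v := fun y => coordVec e i y) (w := fun y => coordVec e j y)
    (g.contMDiff.contMDiffAt.comp y hs) (hv i) (hv j)
  rw [contMDiffAt_totalSpace] at h
  exact h.2.contMDiffWithinAt

theorem metricMat_symm (y : Euc n) (i j : Fin n) : metricMat g e y i j = metricMat g e y j i :=
  g.symm _ _ _

theorem metricMat_posDef (he : e ∈ atlas (Euc n) M) {y : Euc n} (hy : y ∈ e.target) :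
    (metricMat g e y).PosDef := by
  refine Matrix.PosDef.of_dotProduct_mulVec_pos ?_ fun v hv => ?_
  · ext i j
    exact metricMat_symm g y j i
  set w : Euc n := WithLp.toLp 2 v
  have hw : w = ∑ i, v i • EuclideanSpace.single i (1 : ℝ) := by
    ext j
    simp [w, Finset.sum_apply, Pi.single_apply]
  let D : Euc n →L[ℝ] TangentSpace (𝓡 n) (e.symm y) := mfderiv (𝓡 n) (𝓡 n) e.symm y
  have hinj : Function.Injective D :=
    (mdifferentiable_of_mem_atlas (I := 𝓡 n) he).symm.mfderiv_injective hy
  have hw0 : D w ≠ 0 := fun h0 => by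
    have : w = 0 := hinj (by rw [h0, map_zero])
    exact hv (by simpa [w] using this)
  have hpos := g.pos (e.symm y) (D w) hw0
  have hc : ∀ i, D (EuclideanSpace.single i 1) = coordVec e i y := fun _ => rfl
  have hval : star v ⬝ᵥ (metricMat g e y *ᵥ v) = g.inner (e.symm y) (D w) (D w) := by
    rw [hw]
    simp only [map_sum, map_smul, _root_.sum_apply, _root_.smul_apply, hc,
      dotProduct, Matrix.mulVec, metricMat, Matrix.of_apply, smul_eq_mul, star_trivial,
      Finset.mul_sum]
    rw [Finset.sum_comm]
    exact Finset.sum_congr rfl fun i _ => Finset.sum_congr rfl fun j _ => by ring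
  rw [hval]
  exact hpos

theorem contDiffOn_invMetricMat (he : e ∈ atlas (Euc n) M) (i j : Fin n) :
    ContDiffOn ℝ ∞ (fun y => invMetricMat g e y i j) e.target :=
  contDiffOn_inv (contDiffOn_metricMat g he)
    (fun _ hy => (metricMat_posDef g he hy).det_pos.ne') i j

theorem invMetricMat_symm (he : e ∈ atlas (Euc n) M) {y : Euc n} (hy : y ∈ e.target)
    (i j : Fin n) : invMetricMat g e y i j = invMetricMat g e y j i := by
  have := (metricMat_posDef g he hy).inv.isHermitian.apply j i
  simpa [invMetricMat] using this

theorem contDiffOn_christoffel (he : e ∈ atlas (Euc n) M) (m i j : Fin n) :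
    ContDiffOn ℝ ∞ (christoffel g e m i j) e.target := by
  have hpd := fun a b c => contDiffOn_pd e.open_target (contDiffOn_metricMat g he b c) a
  exact contDiffOn_const.mul (ContDiffOn.sum fun l _ =>
    (contDiffOn_invMetricMat g he m l).mul (((hpd _ _ _).add (hpd _ _ _)).sub (hpd _ _ _)))

theorem contDiffOn_ricciMat (he : e ∈ atlas (Euc n) M) (i j : Fin n) :
    ContDiffOn ℝ ∞ (fun y => ricciMat g e y i j) e.target := by
  have hc := contDiffOn_christoffel g he
  have hpd := fun a m b c => contDiffOn_pd e.open_target (hc m b c) a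
  exact (ContDiffOn.sum fun m _ => (hpd _ _ _ _).sub (hpd _ _ _ _)).add
    (ContDiffOn.sum fun m _ => ContDiffOn.sum fun l _ =>
      ((hc _ _ _).mul (hc _ _ _)).sub ((hc _ _ _).mul (hc _ _ _)))

theorem contDiffOn_schoutenMat (he : e ∈ atlas (Euc n) M) (τ : ℝ) (i j : Fin n) :
    ContDiffOn ℝ ∞ (fun y => schoutenMat g e τ y i j) e.target := by
  have hR : ContDiffOn ℝ ∞ (scalarCurv g e) e.target :=
    ContDiffOn.sum fun a _ => ContDiffOn.sum fun b _ =>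
      (contDiffOn_invMetricMat g he a b).mul (contDiffOn_ricciMat g he a b)
  exact contDiffOn_const.mul ((contDiffOn_ricciMat g he i j).sub
    (((contDiffOn_const.mul hR).div_const _).mul (contDiffOn_metricMat g he i j)))

theorem christoffel_symm (m i j : Fin n) : christoffel g e m i j = christoffel g e m j i := by
  ext y
  simp only [christoffel, metricMat_symm g _ i j]
  congr 1
  refine Finset.sum_congr rfl fun l _ => ?_
  ring

/-- The contracted Christoffel symbols `Γ^m_im = ½ g^ml ∂_i g_ml`. -/
theorem sum_christoffel (he : e ∈ atlas (Euc n) M) {y : Euc n} (hy : y ∈ e.target) (i : Fin n) :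
    ∑ m, christoffel g e m i m y = (1 / 2) * ∑ m, ∑ l, invMetricMat g e y m l *
      pd i (fun z => metricMat g e z m l) y := by
  simp only [christoffel]
  rw [← Finset.mul_sum]
  congr 1
  have h : ∑ m, ∑ l, invMetricMat g e y m l * pd m (fun z => metricMat g e z i l) y =
      ∑ m, ∑ l, invMetricMat g e y m l * pd l (fun z => metricMat g e z i m) y := by
    rw [Finset.sum_comm]
    exact Finset.sum_congr rfl fun a _ => Finset.sum_congr rfl fun b _ => by
      rw [invMetricMat_symm g he hy]
  simp only [mul_sub, mul_add, Finset.sum_sub_distrib, Finset.sum_add_distrib]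
  rw [h]
  ring

/-- The derivative of the inverse metric. -/
theorem pd_invMetricMat (he : e ∈ atlas (Euc n) M) {y : Euc n} (hy : y ∈ e.target) (i : Fin n) :
    (Matrix.of fun a b => pd i (fun z => invMetricMat g e z a b) y) =
      -(invMetricMat g e y * (Matrix.of fun a b => pd i (fun z => metricMat g e z a b) y) *
        invMetricMat g e y) := by
  set D := Matrix.of fun a b => pd i (fun z => invMetricMat g e z a b) y
  set E := Matrix.of fun a b => pd i (fun z => metricMat g e z a b) y
  have hinv : ∀ z ∈ e.target, invMetricMat g e z * metricMat g e z = 1 := fun z hz =>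
    Matrix.nonsing_inv_mul _ (metricMat_posDef g he hz).det_pos.ne'.isUnit
  have hinv' : metricMat g e y * invMetricMat g e y = 1 :=
    Matrix.mul_nonsing_inv _ (metricMat_posDef g he hy).det_pos.ne'.isUnit
  have hI := fun a b => differentiableAt_of_contDiffOn e.open_target
    (contDiffOn_invMetricMat g he a b) hy
  have hG := fun a b => differentiableAt_of_contDiffOn e.open_target
    (contDiffOn_metricMat g he a b) hy
  have key : D * metricMat g e y + invMetricMat g e y * E = 0 := by
    ext a b
    have h1 : pd i (fun z => ∑ c, invMetricMat g e z a c * metricMat g e z c b) y = 0 := by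
      rw [pd_congr e.open_target (g := fun _ => (1 : Matrix (Fin n) (Fin n) ℝ) a b) ?_ hy,
        pd_const]
      intro z hz
      simp only [← Matrix.mul_apply, hinv z hz]
    rw [pd_sum _ fun c _ => (hI a c).fun_mul (hG c b)] at h1
    simp only [pd_mul (hI _ _) (hG _ _), Finset.sum_add_distrib] at h1
    simpa [Matrix.mul_apply, D, E] using h1
  calc D = D * metricMat g e y * invMetricMat g e y := by
        rw [Matrix.mul_assoc, hinv', Matrix.mul_one]
    _ = _ := by rw [eq_neg_of_add_eq_zero_left key, Matrix.neg_mul]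

/-- Classically Γ^m_im = ∂_i log √(det g), so both sides are the same mixed second derivative. This
is the one part of the Ricci formula whose symmetry is not purely algebraic. -/
theorem sum_pd_christoffel_symm (he : e ∈ atlas (Euc n) M) {y : Euc n} (hy : y ∈ e.target)
    (i j : Fin n) :
    ∑ m, pd j (christoffel g e m i m) y = ∑ m, pd i (christoffel g e m j m) y := by
  have hI := fun a b => differentiableAt_of_contDiffOn e.open_target
    (contDiffOn_invMetricMat g he a b) hy
  have hpd := fun c a b => differentiableAt_of_contDiffOn e.open_target
    (contDiffOn_pd e.open_target (contDiffOn_metricMat g he a b) c) hy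
  have hsymE : ∀ c, (Matrix.of fun a b => pd c (fun z => metricMat g e z a b) y)ᵀ =
      Matrix.of fun a b => pd c (fun z => metricMat g e z a b) y := by
    intro c
    ext a b
    simp only [Matrix.transpose_apply, Matrix.of_apply, metricMat_symm g _ a b]
  -- Differentiating ½ g^ml ∂_i g_ml gives a trace, symmetric in i and j by cyclicity, and a term
  -- with commuting second derivatives of g.
  have main : ∀ i j : Fin n, ∑ m, pd j (christoffel g e m i m) y =
      (1 / 2) * (-(invMetricMat g e y *
        (Matrix.of fun a b => pd j (fun z => metricMat g e z a b) y) * invMetricMat g e y *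
        (Matrix.of fun a b => pd i (fun z => metricMat g e z a b) y)).trace +
        ∑ m, ∑ l, invMetricMat g e y m l * pd j (pd i (fun z => metricMat g e z m l)) y) := by
    intro i j
    rw [← pd_sum _ fun m _ => differentiableAt_of_contDiffOn e.open_target
      (contDiffOn_christoffel g he m i m) hy]
    rw [pd_congr e.open_target (fun z hz => sum_christoffel g he hz i) hy]
    have hterm := fun m l => (hI m l).fun_mul (hpd i m l)
    rw [pd_const_mul (DifferentiableAt.fun_sum fun m _ => DifferentiableAt.fun_sum fun l _ =>
      hterm m l), pd_sum _ fun m _ => DifferentiableAt.fun_sum fun l _ => hterm m l]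
    congr 1
    have e1 : ∀ m, pd j (fun z => ∑ l, invMetricMat g e z m l *
        pd i (fun z => metricMat g e z m l) z) y =
        ∑ l, (pd j (fun z => invMetricMat g e z m l) y * pd i (fun z => metricMat g e z m l) y +
          invMetricMat g e y m l * pd j (pd i (fun z => metricMat g e z m l)) y) := by
      intro m
      rw [pd_sum _ fun l _ => hterm m l]
      exact Finset.sum_congr rfl fun l _ => pd_mul (hI m l) (hpd i m l) j
    simp only [e1, Finset.sum_add_distrib]
    congr 1
    rw [← Matrix.trace_neg, ← Matrix.neg_mul, ← pd_invMetricMat g he hy j]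
    rw [← hsymE i]
    simp [Matrix.trace, Matrix.mul_apply]
  rw [main i j, main j i]
  congr 2
  · congr 1
    rw [Matrix.trace_mul_comm, ← Matrix.mul_assoc, ← Matrix.mul_assoc, Matrix.trace_mul_comm]
    simp only [Matrix.mul_assoc]
  · refine Finset.sum_congr rfl fun m _ => Finset.sum_congr rfl fun l _ => ?_
    rw [pd_comm e.open_target (contDiffOn_metricMat g he m l) hy]

/-- The coordinate formula is not visibly symmetric; symmetry is what guarantees n real eigenvalues
for g⁻¹A^τ and g⁻¹U^t. -/
theorem ricciMat_isHermitian (he : e ∈ atlas (Euc n) M) {y : Euc n} (hy : y ∈ e.target) :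
    (ricciMat g e y).IsHermitian := by
  ext i j
  simp only [Matrix.conjTranspose_apply, star_trivial, ricciMat, Matrix.of_apply,
    Finset.sum_sub_distrib]
  rw [sum_pd_christoffel_symm g he hy j i, Finset.sum_comm
    (f := fun m l => christoffel g e m i l y * christoffel g e l j m y)]
  simp only [christoffel_symm g _ j i]
  congr 2
  exact Finset.sum_congr rfl fun m _ => Finset.sum_congr rfl fun l _ => mul_comm _ _

theorem metricMat_isHermitian (y : Euc n) : (metricMat g e y).IsHermitian := by
  ext i j
  exact metricMat_symm g y j i

theorem schoutenMat_isHermitian (he : e ∈ atlas (Euc n) M) (τ : ℝ) {y : Euc n}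
    (hy : y ∈ e.target) : (schoutenMat g e τ y).IsHermitian := by
  have hsmul : ∀ (c : ℝ) {A : Matrix (Fin n) (Fin n) ℝ}, A.IsHermitian → (c • A).IsHermitian :=
    fun c A hA => by
      ext i j
      simpa using congrArg (c * ·) (hA.apply i j)
  exact hsmul _ ((ricciMat_isHermitian g he hy).sub (hsmul _ (metricMat_isHermitian g y)))

end Geometry

end KrylovSchouten

/-! ### The scalar equation at a point: bounds on u from bounds on the σ_j. -/

namespace KrylovSchouten

open scoped Matrix

section Algebra

theorem esymm_replicate_one (N j : ℕ) : (Multiset.replicate N (1 : ℝ)).esymm j = N.choose j := by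
  induction N generalizing j with
  | zero =>
    cases j with
    | zero => simp [esymm_zero]
    | succ j => rw [esymm_eq_zero_of_card_lt (by simp)]; simp
  | succ N ih =>
    cases j with
    | zero => simp [esymm_zero]
    | succ j =>
      rw [Multiset.replicate_succ, esymm_cons_succ, ih, ih, Nat.choose_succ_succ]
      push_cast
      ring

theorem cConst_pos {n k : ℕ} (hk : 2 ≤ k) (hkn : k ≤ n) : 0 < cConst n k := by
  simp only [cConst, sigma, esymm_replicate_one]
  refine div_pos (by exact_mod_cast Nat.choose_pos hkn) (Finset.sum_pos (fun l hl => ?_) ?_)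
  · have := Finset.mem_range.1 hl
    exact_mod_cast Nat.choose_pos (by omega)
  · exact ⟨0, by simp; omega⟩

/-- The scalar equation, at one point, satisfied by the eigenvalues `s` and the value `u`. -/
def PointEquation (k : ℕ) (β : ℕ → ℝ) (a u : ℝ) (s : Multiset ℝ) : Prop :=
  sigma k s / sigma (k - 1) s - (∑ l ∈ Finset.range (k - 1),
    β l * Real.exp (2 * ((k : ℝ) - (l : ℝ)) * u) * sigma l s) / sigma (k - 1) s =
      -(a * Real.exp (2 * u))

theorem PointEquation.sum_eq {k : ℕ} {β : ℕ → ℝ} {a u : ℝ} {s : Multiset ℝ}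
    (h : PointEquation k β a u s) (hs : InGamma (k - 1) s) :
    ∑ l ∈ Finset.range (k - 1), β l * Real.exp (2 * ((k : ℝ) - (l : ℝ)) * u) * s.esymm l =
      s.esymm k + a * Real.exp (2 * u) * s.esymm (k - 1) := by
  have hpos := hs.esymm_pos le_rfl
  rw [PointEquation, ← sub_div] at h
  simp only [sigma] at h
  rw [div_eq_iff hpos.ne'] at h
  linarith

/-- A bound on σ_1 controls σ_k and σ_{k-1}, as k ≥ 3 gives Γ_{k-1} ⊆ Γ_2. The terms of the sum are
positive, so the one with l = 0 alone satisfies b e^{2ku} ≤ C₁ + K C₂ e^{2u}; for u > 0, dividing by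
e^{2u} bounds e^{2(k-1)u}. -/
theorem exists_upper_bound (N k : ℕ) (hk : 3 ≤ k) (T K : ℝ) {b : ℝ} (hb : 0 < b) :
    ∃ C : ℝ, ∀ (s : Multiset ℝ) (β : ℕ → ℝ) (a u : ℝ), s.card = N → InGamma (k - 1) s →
      s.esymm 1 ≤ T → (∀ l ≤ k - 2, b ≤ β l) → |a| ≤ K → PointEquation k β a u s → u ≤ C := by
  obtain ⟨C₁, hC₁, h₁⟩ := exists_abs_esymm_le N k T
  obtain ⟨C₂, hC₂, h₂⟩ := exists_abs_esymm_le N (k - 1) T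
  refine ⟨max 0 ((C₁ + K * C₂) / b), fun s β a u hcard hs hT hβ ha h => ?_⟩
  rcases le_or_gt u 0 with hu | hu
  · exact hu.trans (le_max_left _ _)
  refine le_trans ?_ (le_max_right _ _)
  have hs2 : InGamma 2 s := hs.mono (by omega)
  have e1 := (le_abs_self _).trans (h₁ s hcard hs2 hT)
  have e2 := (le_abs_self _).trans (h₂ s hcard hs2 hT)
  have hpos := hs.esymm_pos le_rfl
  have hE : 1 ≤ Real.exp (2 * u) := Real.one_le_exp (by linarith)
  have hk3 : (3 : ℝ) ≤ k := by exact_mod_cast hk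
  have hfirst : b * Real.exp (2 * ((k : ℝ) - ((0 : ℕ) : ℝ)) * u) ≤
      ∑ l ∈ Finset.range (k - 1), β l * Real.exp (2 * ((k : ℝ) - (l : ℝ)) * u) * s.esymm l := by
    have h0 : β 0 * Real.exp (2 * ((k : ℝ) - ((0 : ℕ) : ℝ)) * u) * s.esymm 0 ≤ _ :=
      Finset.single_le_sum (f := fun l : ℕ => β l * Real.exp (2 * ((k : ℝ) - (l : ℝ)) * u) *
        s.esymm l) (fun l hl => by
          have hl' := Finset.mem_range.1 hl
          have := hs.esymm_pos (show l ≤ k - 1 by omega)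
          have := hb.le.trans (hβ l (by omega))
          positivity) (Finset.mem_range.2 (by omega : 0 < k - 1))
    rw [esymm_zero, mul_one] at h0
    exact (mul_le_mul_of_nonneg_right (hβ 0 (by omega)) (Real.exp_pos _).le).trans h0
  rw [h.sum_eq hs] at hfirst
  have hexp : Real.exp (2 * ((k : ℝ) - ((0 : ℕ) : ℝ)) * u) =
      Real.exp (2 * u) * Real.exp (2 * ((k : ℝ) - 1) * u) := by
    rw [← Real.exp_add]
    congr 1
    push_cast
    ring
  have hu2 : u ≤ Real.exp (2 * ((k : ℝ) - 1) * u) := by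
    have := Real.add_one_le_exp (2 * ((k : ℝ) - 1) * u)
    nlinarith
  have haE : a * Real.exp (2 * u) * s.esymm (k - 1) ≤ Real.exp (2 * u) * (K * C₂) := by
    have : a * s.esymm (k - 1) ≤ K * C₂ :=
      mul_le_mul ((le_abs_self a).trans ha) e2 hpos.le ((abs_nonneg a).trans ha)
    nlinarith
  rw [hexp] at hfirst
  have hfin : Real.exp (2 * u) * (b * Real.exp (2 * ((k : ℝ) - 1) * u)) ≤
      Real.exp (2 * u) * (C₁ + K * C₂) := by nlinarith
  rw [mul_le_mul_iff_right₀ (Real.exp_pos _)] at hfin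
  rw [le_div_iff₀ hb]
  nlinarith

/-- For u < 0 every e^{2(k-l)u} with l < k is at most e^{2u}. Replacing each σ_l by Zσ_k and
cancelling σ_k > 0 leaves a positive lower bound on e^{2u}. -/
theorem exists_lower_bound (k : ℕ) (hk : 2 ≤ k) (Z D K : ℝ) :
    ∃ C : ℝ, ∀ (s : Multiset ℝ) (β : ℕ → ℝ) (a u : ℝ), InGamma k s →
      (∀ l ≤ k, s.esymm l ≤ Z * s.esymm k) → (∀ l ≤ k - 2, 0 ≤ β l ∧ β l ≤ D) → |a| ≤ K →
      PointEquation k β a u s → C ≤ u := by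
  -- The sum has k - 1 terms, each at most D Z e^{2u} σ_k; the α-term contributes K Z.
  refine ⟨min 0 (-(((k - 1 : ℕ) * (D * Z) + K * Z) / 2)), fun s β a u hs hσ hβ ha h => ?_⟩
  rcases le_or_gt 0 u with hu | hu
  · exact (min_le_left _ _).trans hu
  refine (min_le_right _ _).trans ?_
  have hk1 := hs.esymm_pos (show k - 1 ≤ k by omega)
  have hk0 := hs.esymm_pos le_rfl
  have hD : 0 ≤ D := (hβ 0 (by omega)).1.trans (hβ 0 (by omega)).2
  have hK : 0 ≤ K := (abs_nonneg a).trans ha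
  have hsum : ∑ l ∈ Finset.range (k - 1), β l * Real.exp (2 * ((k : ℝ) - (l : ℝ)) * u) *
      s.esymm l ≤ ∑ l ∈ Finset.range (k - 1), D * Real.exp (2 * u) * (Z * s.esymm k) := by
    refine Finset.sum_le_sum fun l hl => ?_
    have hl' := Finset.mem_range.1 hl
    have h1 := hβ l (by omega)
    have h2 := hs.esymm_pos (show l ≤ k by omega)
    have h3 : Real.exp (2 * ((k : ℝ) - (l : ℝ)) * u) ≤ Real.exp (2 * u) := by
      refine Real.exp_le_exp.2 ?_
      have : (l : ℝ) + 1 ≤ k := by exact_mod_cast (by omega : l + 1 ≤ k)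
      nlinarith
    exact mul_le_mul (mul_le_mul h1.2 h3 (Real.exp_pos _).le hD) (hσ l (by omega)) h2.le
      (by positivity)
  rw [h.sum_eq (hs.mono (by omega)), Finset.sum_const, Finset.card_range, nsmul_eq_mul] at hsum
  have haE : -(a * Real.exp (2 * u) * s.esymm (k - 1)) ≤
      K * Real.exp (2 * u) * (Z * s.esymm k) := by
    have h1 : -a * s.esymm (k - 1) ≤ K * (Z * s.esymm k) :=
      mul_le_mul ((neg_le_abs a).trans ha) (hσ _ (by omega)) hk1.le hK
    have := mul_le_mul_of_nonneg_left h1 (Real.exp_pos (2 * u)).le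
    linarith
  have hmain : 1 ≤ Real.exp (2 * u) * ((k - 1 : ℕ) * (D * Z) + K * Z) := by
    by_contra! hlt
    nlinarith
  have hinv : Real.exp (-(2 * u)) ≤ (k - 1 : ℕ) * (D * Z) + K * Z := by
    have := mul_le_mul_of_nonneg_left hmain (Real.exp_pos (-(2 * u))).le
    rw [← mul_assoc, ← Real.exp_add, neg_add_cancel, Real.exp_zero, mul_one, one_mul] at this
    exact this
  have := Real.add_one_le_exp (-(2 * u))
  linarith

end Algebra

/-! ### Trace positivity and the tensor U^t at extrema of u. -/

section Trace

variable {n : ℕ} {G P : Matrix (Fin n) (Fin n) ℝ}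

theorem trace_inv_mul_nonneg (hG : G.PosDef) (hP : P.PosSemidef) : 0 ≤ (G⁻¹ * P).trace := by
  obtain ⟨Q, hQ⟩ := exists_congr_one hG
  rw [inv_eq_of_congr_one hQ, Matrix.mul_assoc, Matrix.trace_mul_comm,
    ← Matrix.conjTranspose_eq_transpose_of_trivial]
  exact (hP.conjTranspose_mul_mul_same Q).trace_nonneg

theorem isHermitian_smul {A : Matrix (Fin n) (Fin n) ℝ} (hA : A.IsHermitian) (c : ℝ) :
    (c • A).IsHermitian := by
  ext i j
  simpa using congrArg (c * ·) (hA.apply i j)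

end Trace

section CriticalPoint

variable {n : ℕ} {M : Type*} [TopologicalSpace M] {e : OpenPartialHomeomorph M (Euc n)}

/-- The coordinate second derivatives of `u`, without the Christoffel correction. -/
noncomputable def coordHess (e : OpenPartialHomeomorph M (Euc n)) (u : M → ℝ) (y : Euc n) :
    Matrix (Fin n) (Fin n) ℝ :=
  Matrix.of fun i j => pd i (pd j fun z => u (e.symm z)) y

theorem isLocalMin_comp_symm {u : M → ℝ} {x : M} (hx : x ∈ e.source)
    (h : ∀ z, u x ≤ u z) : IsLocalMin (fun z => u (e.symm z)) (e x) :=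
  Filter.Eventually.of_forall fun z => by
    simp only [e.left_inv hx]
    exact h _

theorem coordHess_neg {u : M → ℝ} (y : Euc n) :
    coordHess e (fun x => -u x) y = -coordHess e u y := by
  ext i j
  have h1 : (pd j fun z => -u (e.symm z)) = fun z => -pd j (fun z => u (e.symm z)) z :=
    funext fun z => pd_neg j _ z
  simp only [coordHess, h1, Matrix.of_apply, Matrix.neg_apply]
  exact pd_neg i _ y

theorem du_eq_zero_of_isMin {u : M → ℝ} {x : M} (hx : x ∈ e.source) (h : ∀ z, u x ≤ u z)
    (i : Fin n) : du e u i (e x) = 0 :=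
  pd_eq_zero_of_isLocalExtr (Or.inl (isLocalMin_comp_symm hx h)) i

theorem du_eq_zero_of_isMax {u : M → ℝ} {x : M} (hx : x ∈ e.source) (h : ∀ z, u z ≤ u x)
    (i : Fin n) : du e u i (e x) = 0 :=
  pd_eq_zero_of_isLocalExtr (Or.inr (Filter.Eventually.of_forall fun z => by
    simp only [e.left_inv hx]
    exact h _)) i

end CriticalPoint

section Extrema

variable {n : ℕ} {M : Type*} [TopologicalSpace M] [ChartedSpace (Euc n) M]
  [IsManifold (𝓡 n) ∞ M] (g : SmoothMetric n M) {e : OpenPartialHomeomorph M (Euc n)}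

theorem contDiffOn_comp_symm (he : e ∈ atlas (Euc n) M) {u : M → ℝ}
    (hu : ContMDiff (𝓡 n) 𝓘(ℝ, ℝ) ∞ u) : ContDiffOn ℝ ∞ (fun z => u (e.symm z)) e.target := by
  rw [← contMDiffOn_iff_contDiffOn]
  exact hu.comp_contMDiffOn
    (contMDiffOn_symm_of_mem_maximalAtlas (IsManifold.subset_maximalAtlas he))

theorem coordHess_isHermitian (he : e ∈ atlas (Euc n) M) {u : M → ℝ}
    (hu : ContMDiff (𝓡 n) 𝓘(ℝ, ℝ) ∞ u) {y : Euc n} (hy : y ∈ e.target) :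
    (coordHess e u y).IsHermitian := by
  ext i j
  simpa [coordHess] using pd_comm e.open_target (contDiffOn_comp_symm he hu) hy j i

/-- The tensor `U^t` at a critical point of `u`. -/
theorem Umat_of_du_eq_zero (τ t : ℝ) {u : M → ℝ} {y : Euc n} (hdu : ∀ i, du e u i y = 0)
    (hH : (coordHess e u y).IsHermitian) :
    Umat g e τ t u y = (t • (-schoutenMat g e τ y) + (1 - t) • metricMat g e y) +
      (coordHess e u y + ((1 - τ) / ((n : ℝ) - 2) *
        ((metricMat g e y)⁻¹ * coordHess e u y).trace) • metricMat g e y) := by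
  have hhess : hessMat g e u y = coordHess e u y := by
    ext i j
    simp only [hessMat, hdu, mul_zero, Finset.sum_const_zero, sub_zero, Matrix.of_apply]
    rfl
  have hlap : lap g e u y = ((metricMat g e y)⁻¹ * coordHess e u y).trace := by
    simp only [lap, hhess, Matrix.trace, Matrix.diag_apply, Matrix.mul_apply, invMetricMat]
    exact Finset.sum_congr rfl fun i _ => Finset.sum_congr rfl fun j _ => by
      rw [← hH.apply i j, star_trivial]
  have hgrad : gradSq g e u y = 0 := by simp [gradSq, hdu]
  have hdudu : (Matrix.of fun i j => du e u i y * du e u j y) = 0 := by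
    ext i j
    simp [hdu]
  rw [Umat, hhess, hlap, hgrad, hdudu, mul_zero, zero_smul, smul_neg]
  abel

theorem coordHess_posSemidef (he : e ∈ atlas (Euc n) M) {u : M → ℝ}
    (hu : ContMDiff (𝓡 n) 𝓘(ℝ, ℝ) ∞ u) {x : M} (hx : x ∈ e.source) (h : ∀ z, u x ≤ u z) :
    (coordHess e u (e x)).PosSemidef :=
  posSemidef_pd_pd_of_isLocalMin e.open_target (contDiffOn_comp_symm he hu) (e.map_source hx)
    (isLocalMin_comp_symm hx h)

/-- At a maximum point, the trace of `U^t` is at most that of `-tA^τ + (1-t)g`. -/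
theorem sigma_one_lambdaU_le (hn : 3 ≤ n) (he : e ∈ atlas (Euc n) M) {τ t : ℝ} (hτ : τ < 1)
    (ht0 : 0 ≤ t) (ht1 : t ≤ 1) {u : M → ℝ} (hu : ContMDiff (𝓡 n) 𝓘(ℝ, ℝ) ∞ u) {x : M}
    (hx : x ∈ e.source) (h : ∀ z, u z ≤ u x) {T : ℝ}
    (hT : ((metricMat g e (e x))⁻¹ * (-schoutenMat g e τ (e x))).trace ≤ T) :
    (lambdaU g e τ t u x).card = n ∧ (lambdaU g e τ t u x).esymm 1 ≤ |T| + n := by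
  have hy := e.map_source hx
  have hG := metricMat_posDef g he hy
  have hH := coordHess_isHermitian he hu hy
  have hU := Umat_of_du_eq_zero g τ t (du_eq_zero_of_isMax hx h) hH
  have hA := (schoutenMat_isHermitian g he τ hy).neg
  have hUs : (Umat g e τ t u (e x)).IsHermitian := by
    rw [hU]
    exact ((isHermitian_smul hA _).add (isHermitian_smul hG.isHermitian _)).add
      (hH.add (isHermitian_smul hG.isHermitian _))
  refine ⟨card_eigenvalues hG hUs, ?_⟩
  have htr := sigma_one_eigenvalues hG hUs
  -- Δu ≤ 0 at a maximum, from the minimum case applied to -u.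
  have hΔ : ((metricMat g e (e x))⁻¹ * coordHess e u (e x)).trace ≤ 0 := by
    have := trace_inv_mul_nonneg hG (coordHess_posSemidef he hu.neg hx
      (fun z => neg_le_neg (h z)))
    erw [coordHess_neg] at this
    rw [Matrix.mul_neg, Matrix.trace_neg] at this
    linarith
  have hn3 : (3 : ℝ) ≤ n := by exact_mod_cast hn
  have hc : 0 ≤ (1 - τ) / ((n : ℝ) - 2) := div_nonneg (by linarith) (by linarith)
  have h1 : (metricMat g e (e x))⁻¹ * metricMat g e (e x) = 1 :=
    Matrix.nonsing_inv_mul _ hG.det_pos.ne'.isUnit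
  change sigma 1 (eigenvalues ((metricMat g e (e x))⁻¹ * Umat g e τ t u (e x))) ≤ _
  rw [htr, hU]
  simp only [Matrix.mul_add, Matrix.mul_smul, h1, Matrix.trace_add, Matrix.trace_smul,
    Matrix.trace_one, Fintype.card_fin, smul_eq_mul]
  have e1 : t * ((metricMat g e (e x))⁻¹ * (-schoutenMat g e τ (e x))).trace ≤ |T| := by
    have := le_abs_self T
    have := abs_nonneg T
    nlinarith
  have e2 : (1 - τ) / ((n : ℝ) - 2) *
      ((metricMat g e (e x))⁻¹ * coordHess e u (e x)).trace * n ≤ 0 :=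
    mul_nonpos_of_nonpos_of_nonneg (mul_nonpos_of_nonneg_of_nonpos hc hΔ) (by linarith)
  nlinarith

/-- At a minimum point, the eigenvalues of `U^t` are those of an element of `Γ_k`, shifted
by `δ`. -/
theorem exists_lambdaU_eq (hn : 3 ≤ n) (he : e ∈ atlas (Euc n) M) {τ t : ℝ} (hτ : τ < 1)
    (ht0 : 0 ≤ t) (ht1 : t ≤ 1) {u : M → ℝ} (hu : ContMDiff (𝓡 n) 𝓘(ℝ, ℝ) ∞ u) {x : M}
    (hx : x ∈ e.source) (h : ∀ z, u x ≤ u z) {k : ℕ} (hk : k ≤ n) {δ : ℝ} (hδ1 : δ < 1)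
    (hA : InGamma k (eigenvalues ((metricMat g e (e x))⁻¹ *
      (-schoutenMat g e τ (e x) + (-δ) • metricMat g e (e x))))) :
    ∃ s : Multiset ℝ, s.card = n ∧ InGamma k s ∧ lambdaU g e τ t u x = s.map (· + δ) := by
  have hy := e.map_source hx
  have hG := metricMat_posDef g he hy
  have hH := coordHess_isHermitian he hu hy
  have hU := Umat_of_du_eq_zero g τ t (du_eq_zero_of_isMin hx h) hH
  have hAs := (schoutenMat_isHermitian g he τ hy).neg
  have hHP := coordHess_posSemidef he hu hx h
  have hn3 : (3 : ℝ) ≤ n := by exact_mod_cast hn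
  have hc : 0 ≤ (1 - τ) / ((n : ℝ) - 2) := div_nonneg (by linarith) (by linarith)
  have hΔ := trace_inv_mul_nonneg hG hHP
  have hP := hHP.add (hG.posSemidef.smul (mul_nonneg hc hΔ))
  set G := metricMat g e (e x)
  set A := -schoutenMat g e τ (e x)
  set P := coordHess e u (e x) + ((1 - τ) / ((n : ℝ) - 2) * (G⁻¹ * coordHess e u (e x)).trace) • G
  have hAδ : (A + (-δ) • G).IsHermitian := hAs.add (isHermitian_smul hG.isHermitian _)
  have hBs : (t • (A + (-δ) • G) + ((1 - t) * (1 - δ)) • G).IsHermitian :=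
    (isHermitian_smul hAδ _).add (isHermitian_smul hG.isHermitian _)
  -- U^t - δG = t(A - δG) + (1-t)(1-δ)G + P. The first two summands are a nonnegative combination of
  -- an element of Γ_k and the metric; it is nontrivial even at t = 0 because δ < 1.
  have hB : InGamma k (eigenvalues (G⁻¹ * (t • (A + (-δ) • G) + ((1 - t) * (1 - δ)) • G))) := by
    rw [eigenvalues_smul_add hG hAδ]
    refine hA.map_mul_add (by rwa [card_eigenvalues hG hAδ]) ht0
      (mul_nonneg (by linarith) (by linarith)) ?_
    rcases ht0.eq_or_lt with rfl | ht
    · linarith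
    · have := mul_nonneg (sub_nonneg.2 ht1) (sub_nonneg.2 hδ1.le)
      linarith
  have hW := hB.add_posSemidef hG hBs hk hP
  have hWs := hBs.add hP.isHermitian
  refine ⟨_, card_eigenvalues hG hWs, hW, ?_⟩
  have := eigenvalues_smul_add hG hWs 1 δ
  simp only [one_mul] at this
  rw [← this, lambdaU, hU]
  change eigenvalues (G⁻¹ * _) = _
  congr 2
  module

end Extrema

end KrylovSchouten

/-! ### Uniform bounds near a point. -/

namespace KrylovSchouten

open scoped Matrix Topology

section Local

variable {n : ℕ} {M : Type*} [TopologicalSpace M] [ChartedSpace (Euc n) M]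
  [IsManifold (𝓡 n) ∞ M] (g : SmoothMetric n M) {e : OpenPartialHomeomorph M (Euc n)}

theorem continuousAt_inv_mul_neg_schoutenMat (he : e ∈ atlas (Euc n) M) (τ : ℝ) {y : Euc n}
    (hy : y ∈ e.target) :
    ContinuousAt (fun y => (metricMat g e y)⁻¹ * (-schoutenMat g e τ y)) y := by
  have hI := fun i j => ((contDiffOn_invMetricMat g he i j).contDiffAt
    (e.open_target.mem_nhds hy)).continuousAt
  have hA := fun i j => ((contDiffOn_schoutenMat g he τ i j).contDiffAt
    (e.open_target.mem_nhds hy)).continuousAt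
  refine continuousAt_pi.2 fun i => continuousAt_pi.2 fun j => ?_
  simp only [Matrix.mul_apply, Matrix.neg_apply]
  exact tendsto_finsetSum _ fun l _ => (hI i l).mul (hA l j).neg

/-- Near every point the trace of `-A^τ` is bounded and `-A^τ - δ g` stays in `Γ_k`, uniformly. -/
theorem exists_local_bounds {k : ℕ} (hk : k ≤ n) {τ : ℝ} (hA : NegSchoutenInGamma g τ k)
    (x₀ : M) : ∃ e ∈ atlas (Euc n) M, ∃ T δ : ℝ, 0 < δ ∧ δ < 1 ∧ ∀ᶠ x in 𝓝 x₀, x ∈ e.source ∧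
      ((metricMat g e (e x))⁻¹ * (-schoutenMat g e τ (e x))).trace ≤ T ∧
      InGamma k (eigenvalues ((metricMat g e (e x))⁻¹ *
        (-schoutenMat g e τ (e x) + (-δ) • metricMat g e (e x)))) := by
  set e := chartAt (Euc n) x₀
  have he : e ∈ atlas (Euc n) M := chart_mem_atlas _ _
  have hx₀ : x₀ ∈ e.source := mem_chart_source _ _
  have hy₀ := e.map_source hx₀
  set F : Euc n → Matrix (Fin n) (Fin n) ℝ :=
    fun y => (metricMat g e y)⁻¹ * (-schoutenMat g e τ y)
  have hF : ContinuousAt F (e x₀) := continuousAt_inv_mul_neg_schoutenMat g he τ hy₀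
  have hFδ : ContinuousAt (fun p : Euc n × ℝ => F p.1 + (-p.2) • 1) (e x₀, 0) := by
    have h1 : ContinuousAt (fun p : Euc n × ℝ => F p.1) (e x₀, 0) :=
      ContinuousAt.comp (g := F) (f := Prod.fst) hF continuousAt_fst
    exact h1.add (by fun_prop)
  -- Γ_k is open: each σ_j is continuous jointly in the point and the shift δ, and positive at shift
  -- 0.
  have hpos : ∀ j ∈ Finset.Icc 1 k, ∀ᶠ p : Euc n × ℝ in 𝓝 (e x₀) ×ˢ 𝓝 0,
      0 < (-1) ^ j * (F p.1 + (-p.2) • 1).charpoly.coeff (n - j) := by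
    intro j hj
    rw [Finset.mem_Icc] at hj
    rw [← nhds_prod_eq]
    have hc : ContinuousAt (fun p : Euc n × ℝ =>
        (-1) ^ j * (F p.1 + (-p.2) • 1).charpoly.coeff (n - j)) (e x₀, 0) :=
      continuousAt_const.mul (ContinuousAt.comp
        (g := fun P : Matrix (Fin n) (Fin n) ℝ => P.charpoly.coeff (n - j))
        (continuous_charpoly_coeff j (hj.2.trans hk)).continuousAt hFδ)
    refine hc.eventually (lt_mem_nhds ?_)
    simp only [neg_zero, zero_smul, add_zero]
    rw [← sigma_eigenvalues (metricMat_posDef g he hy₀)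
      (schoutenMat_isHermitian g he τ hy₀).neg (hj.2.trans hk)]
    exact hA e he x₀ hx₀ j hj.1 hj.2
  -- Splitting the product neighbourhood lets one δ > 0 serve all nearby points.
  obtain ⟨pa, hpa, pb, hpb, hab⟩ := Filter.eventually_prod_iff.1
    ((Filter.eventually_all_finset _).2 hpos)
  obtain ⟨δ, hδb, hδ0, hδ1⟩ : ∃ δ, pb δ ∧ 0 < δ ∧ δ < 1 := by
    have h1 : ∀ᶠ δ in 𝓝[>] (0 : ℝ), pb δ := hpb.filter_mono nhdsWithin_le_nhds
    have h2 : ∀ᶠ δ in 𝓝[>] (0 : ℝ), δ < 1 :=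
      (gt_mem_nhds one_pos).filter_mono nhdsWithin_le_nhds
    obtain ⟨δ, h⟩ := (h1.and (h2.and self_mem_nhdsWithin)).exists
    exact ⟨δ, h.1, h.2.2, h.2.1⟩
  refine ⟨e, he, (F (e x₀)).trace + 1, δ, hδ0, hδ1, ?_⟩
  have htr : ∀ᶠ y in 𝓝 (e x₀), (F y).trace < (F (e x₀)).trace + 1 :=
    (ContinuousAt.comp (g := Matrix.trace) (Continuous.matrix_trace continuous_id).continuousAt
      hF).eventually (gt_mem_nhds (lt_add_one _))
  have hcont : Filter.Tendsto e (𝓝 x₀) (𝓝 (e x₀)) := e.continuousAt hx₀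
  filter_upwards [e.open_source.mem_nhds hx₀, hcont.eventually htr, hcont.eventually hpa]
    with x hx h1 h2
  refine ⟨hx, h1.le, fun j hj1 hj => ?_⟩
  have hy := e.map_source hx
  have hG := metricMat_posDef g he hy
  rw [sigma_eigenvalues hG ((schoutenMat_isHermitian g he τ hy).neg.add
    (isHermitian_smul hG.isHermitian _)) (hj.trans hk), Matrix.mul_add, Matrix.mul_smul,
    Matrix.nonsing_inv_mul _ hG.det_pos.ne'.isUnit]
  exact hab h2 hδb j (Finset.mem_Icc.2 ⟨hj1, hj⟩)

end Local

end KrylovSchouten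

/-! ### Global bound from the local ones by compactness. -/

theorem lemma3p2 {n : ℕ} (hn : 3 ≤ n) {M : Type*} [TopologicalSpace M] [T2Space M]
    [CompactSpace M] [ChartedSpace (KrylovSchouten.Euc n) M] [IsManifold (𝓡 n) ∞ M]
    (g₀ : KrylovSchouten.SmoothMetric n M) (k : ℕ) (hk : 3 ≤ k) (hkn : k ≤ n)
    (τ : ℝ) (hτ : τ < 1) (hA : KrylovSchouten.NegSchoutenInGamma g₀ τ k)
    -- bounds for the norm of `α`, the norms of the `α_l`, and the infima of the `α_l`
    (K : ℝ) (L m : ℕ → ℝ) (hm : ∀ l : ℕ, l ≤ k - 2 → 0 < m l) :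
    ∃ C : ℝ, ∀ (α : M → ℝ) (αl : ℕ → M → ℝ),
      ContMDiff (𝓡 n) 𝓘(ℝ, ℝ) ∞ α → (∀ x, |α x| ≤ K) →
      (∀ l : ℕ, l ≤ k - 2 → ContMDiff (𝓡 n) 𝓘(ℝ, ℝ) ∞ (αl l) ∧
        ∀ x, |αl l x| ≤ L l ∧ m l ≤ αl l x) →
      ∀ t : ℝ, 0 ≤ t → t ≤ 1 →
      ∀ u : M → ℝ, ContMDiff (𝓡 n) 𝓘(ℝ, ℝ) ∞ u →
        KrylovSchouten.UInGamma g₀ τ t u (k - 1) →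
        KrylovSchouten.SolvesFamily g₀ τ k α αl t u →
        ∀ x, |u x| ≤ C := by
  open KrylovSchouten in
  have hc := cConst_pos (n := n) (k := k) (by omega) hkn
  -- The coefficients (1-t)c + tα_l are convex combinations of c and α_l, so b and, below, D bound
  -- them uniformly in t. The indices l ≤ k - 2 are those of `Finset.range (k - 1)`.
  obtain ⟨b, hb, hbc, hbm⟩ : ∃ b : ℝ, 0 < b ∧ b ≤ cConst n k ∧ ∀ l ≤ k - 2, b ≤ m l := by
    obtain ⟨l₀, hl₀, hmin⟩ := (Finset.range (k - 1)).exists_min_image m ⟨0, by simp; omega⟩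
    refine ⟨min (cConst n k) (m l₀), lt_min hc (hm l₀ ?_), min_le_left _ _,
      fun l hl => (min_le_right _ _).trans (hmin l ?_)⟩
    · have := Finset.mem_range.1 hl₀
      omega
    · exact Finset.mem_range.2 (by omega)
  obtain ⟨D, hDc, hDL⟩ : ∃ D : ℝ, cConst n k ≤ D ∧ ∀ l ≤ k - 2, L l ≤ D := by
    obtain ⟨l₀, hl₀, hmax⟩ := (Finset.range (k - 1)).exists_max_image L ⟨0, by simp; omega⟩
    exact ⟨max (cConst n k) (L l₀), le_max_left _ _, fun l hl =>
      (hmax l (Finset.mem_range.2 (by omega))).trans (le_max_right _ _)⟩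
  -- All data α, α_l, t are quantified inside, so the constants found by compactness do not depend
  -- on them.
  let Admissible : (M → ℝ) → Prop := fun u => ∃ (α : M → ℝ) (αl : ℕ → M → ℝ) (t : ℝ),
    (∀ x, |α x| ≤ K) ∧ (∀ l ≤ k - 2, ∀ x, |αl l x| ≤ L l ∧ m l ≤ αl l x) ∧ 0 ≤ t ∧ t ≤ 1 ∧
    ContMDiff (𝓡 n) 𝓘(ℝ, ℝ) ∞ u ∧ UInGamma g₀ τ t u (k - 1) ∧ SolvesFamily g₀ τ k α αl t u
  have hcover : ∃ C₁ C₂ : ℝ, ∀ x ∈ (Set.univ : Set M), ∀ u, Admissible u →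
      ((∀ z, u z ≤ u x) → u x ≤ C₁) ∧ ((∀ z, u x ≤ u z) → C₂ ≤ u x) := by
    -- The bound is needed only where x is an extremum of u. Its constants depend on a chart and on
    -- δ and T near x₀, and a finite cover merges them by max and min.
    refine isCompact_univ.induction_on (p := fun S : Set M => ∃ C₁ C₂ : ℝ, ∀ x ∈ S, ∀ u,
      Admissible u → ((∀ z, u z ≤ u x) → u x ≤ C₁) ∧ ((∀ z, u x ≤ u z) → C₂ ≤ u x))
      ⟨0, 0, by simp⟩ ?_ ?_ ?_
    · rintro S S' hSS' ⟨C₁, C₂, h⟩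
      exact ⟨C₁, C₂, fun x hx => h x (hSS' hx)⟩
    · rintro S S' ⟨C₁, C₂, h⟩ ⟨C₁', C₂', h'⟩
      refine ⟨max C₁ C₁', min C₂ C₂', fun x hx u hu => ?_⟩
      rcases hx with hx | hx
      · exact ⟨fun H => ((h x hx u hu).1 H).trans (le_max_left _ _),
          fun H => (min_le_left _ _).trans ((h x hx u hu).2 H)⟩
      · exact ⟨fun H => ((h' x hx u hu).1 H).trans (le_max_right _ _),
          fun H => (min_le_right _ _).trans ((h' x hx u hu).2 H)⟩
    · intro x₀ _
      obtain ⟨e, he, T, δ, hδ0, hδ1, hloc⟩ := exists_local_bounds g₀ hkn hA x₀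
      obtain ⟨Z, -, hZσ⟩ := exists_esymm_le n k hkn hδ0
      obtain ⟨C₁, hC₁⟩ := exists_upper_bound n k hk (|T| + n) K hb
      obtain ⟨C₂, hC₂⟩ := exists_lower_bound k (by omega) Z D K
      refine ⟨_, mem_nhdsWithin_of_mem_nhds hloc, C₁, C₂, ?_⟩
      rintro x ⟨hx, hTx, hΓx⟩ u ⟨α, αl, t, hα, hαl, ht0, ht1, hu, hΓ, hsol⟩
      have heq : PointEquation k (fun l => (1 - t) * cConst n k + t * αl l x) (t * α x) (u x)
          (lambdaU g₀ e τ t u x) := hsol e he x hx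
      have hβ1 : ∀ l ≤ k - 2, b ≤ (1 - t) * cConst n k + t * αl l x := by
        intro l hl
        have h1 := (hbm l hl).trans (hαl l hl x).2
        nlinarith
      have hβ2 : ∀ l ≤ k - 2, (1 - t) * cConst n k + t * αl l x ≤ D := by
        intro l hl
        have h1 := ((le_abs_self _).trans (hαl l hl x).1).trans (hDL l hl)
        nlinarith
      have ha : |t * α x| ≤ K := by
        rw [abs_mul, abs_of_nonneg ht0]
        have := hα x
        have := abs_nonneg (α x)
        nlinarith
      refine ⟨fun H => ?_, fun H => ?_⟩
      · obtain ⟨h1, h2⟩ := sigma_one_lambdaU_le g₀ hn he hτ ht0 ht1 hu hx H hTx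
        exact hC₁ _ _ _ _ h1 (hΓ e he x hx) h2 hβ1 ha heq
      · obtain ⟨s, hs, hsΓ, hsU⟩ := exists_lambdaU_eq g₀ hn he hτ ht0 ht1 hu hx H hkn hδ1 hΓx
        rw [hsU] at heq
        refine hC₂ _ _ _ _ ?_ (hZσ s hs hsΓ) (fun l hl => ⟨hb.le.trans (hβ1 l hl), hβ2 l hl⟩)
          ha heq
        have := hsΓ.map_mul_add (by rwa [hs]) zero_le_one hδ0.le (by linarith)
        simpa only [one_mul] using this
  obtain ⟨C₁, C₂, hC⟩ := hcover
  refine ⟨max C₁ (-C₂), fun α αl _ hα hαl t ht0 ht1 u hu hΓ hsol x => ?_⟩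
  have hadm : Admissible u :=
    ⟨α, αl, t, hα, fun l hl => (hαl l hl).2, ht0, ht1, hu, hΓ, hsol⟩
  -- The given x supplies the nonemptiness needed for extrema to exist.
  obtain ⟨xM, -, hM⟩ := isCompact_univ.exists_isMaxOn ⟨x, Set.mem_univ x⟩ hu.continuous.continuousOn
  obtain ⟨xm, -, hm'⟩ := isCompact_univ.exists_isMinOn ⟨x, Set.mem_univ x⟩ hu.continuous.continuousOn
  have hM' : ∀ z, u z ≤ u xM := fun z => hM (Set.mem_univ z)
  have hm'' : ∀ z, u xm ≤ u z := fun z => hm' (Set.mem_univ z)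
  have h1 := (hC xM (Set.mem_univ _) u hadm).1 hM'
  have h2 := (hC xm (Set.mem_univ _) u hadm).2 hm''
  rw [abs_le]
  constructor
  · have := le_max_right C₁ (-C₂)
    linarith [hm'' x]
  · exact ((hM' x).trans h1).trans (le_max_left _ _)
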